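/- Notation. Let $\overline{\mathbb Q}$ be an algebraic closure of $\mathbb Q$; all number fields below are subfields of $\overline{\mathbb Q}$. Let $\mathcal G=\overline{\mathbb Q}^\times/\mathrm{Tor}(\overline{\mathbb Q}^\times)$ be the group of nonzero algebraic numbers modulo roots of unity, a $\mathbb Q$-vector space written multiplicatively. For a number field $F$ with set of places $M_F$, and for $x\in F^\times$, put $h_1(x)=\sum_{v\in M_F}\frac{[F_v:\mathbb Q_v]}{[F:\mathbb Q]}\,\bigl|\log\|x\|_v\bigr|$, where $\|\cdot\|_v$ extends the usual absolute value of $\mathbb Q$. This does not depend on the choice of $F$, and it induces a vector space norm $h_1$ on $\mathcal G$; we write $\overline{\mathcal G}$ for the completion of $\mathcal G$ and $h_1$ also for the extended norm. For $\alpha\in\mathcal G$ let $d(\alpha)$ be the least degree over $\mathbb Q$ of a representative of $\alpha$ in $\overline{\mathbb Q}^\times$, let $m_1(\alpha)=d(\alpha)h_1(\alpha)$, and let $$\widetilde m_1(\alpha)=\inf\Bigl\{\sum_{i=1}^n |r_i|\,m_1(\alpha_i)\;:\;\alpha=\alpha_1^{r_1}\cdots\alpha_n^{r_n},\ \alpha_i\in\mathcal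 G,\ r_i\in\mathbb Q\Bigr\}.$$ For a number field $F$ let $V_F\subseteq\mathcal G$ be the $\mathbb Q$-subspace spanned by the classes of the elements of $F^\times$. For a finite set $S$ of places of $\mathbb Q$ let $V_{F,S}$ be the space of all $\alpha\in V_F$ such that $\|\alpha\|_w=1$ for every place $w$ of $F$ that does not lie over an element of $S$. Its completion $\overline{V_{F,S}}$ is its closure in $\overline{\mathcal G}$. Theorem. Let $K$ be a finite Galois extension of $\mathbb Q$ and let $\alpha\in V_K$. Then there is a finite set $S$ of places of $\mathbb Q$, containing the archimedean place, such that for every subfield $F\subseteq K$ the $\mathbb Q$-vector space $V_{F,S}$ and the real vector space $\overline{V_{F,S}}$ are finite-dimensional, and there are elements $\alpha_F\in\overline{V_{F,S}}$, one for each subfield $F\subseteq K$, with $$\alpha=\prod_{F\subseteq K}\alpha_F,\qquad \widetilde m_1(\alpha)=\sum_{F\subseteq K}[F:\mathbb Q]\cdot h_1(\alpha_F),$$ and, for all subfields $E\subsetneq F\subseteq K$, $$h_1(\alpha_F)=\inf_{\beta\in V_{E,S}}h_1(\alpha_F/\beta).$$ -/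

import Mathlib

open NumberField
noncomputable section
namespace WeilHeight

/-- The sum over all places `v` of `K` of `[K_v : ℚ_v] * |log ‖x‖_v|`, where `‖·‖_v` extends the usual
absolute value of `ℚ`. At a finite place Mathlib's absolute value is already `‖·‖_v ^ [K_v : ℚ_v]`
(a uniformizer has absolute value `1 / N(v)`); at an infinite place `[K_v : ℚ_v]` is `v.mult`.
For `x ≠ 0` only finitely many terms are nonzero. -/
def localSum (K : Type*) [Field K] [NumberField K] (x : K) : ℝ :=
  ∑ v : InfinitePlace K, (v.mult : ℝ) * |Real.log (v x)| +
    ∑ᶠ v : FinitePlace K, |Real.log (v x)|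

/-- The `L¹` Weil height `∑_v [K_v : ℚ_v] / [K : ℚ] * |log ‖x‖_v|` of `x`, computed in the number
field `K`. -/
def heightIn (K : Type*) [Field K] [NumberField K] (x : K) : ℝ :=
  localSum K x / (Module.finrank ℚ K : ℝ)

section
variable {K : Type*} [Field K] [NumberField K]

theorem finite_support_log {x : K} (hx : x ≠ 0) :
    (Function.support fun v : FinitePlace K => |Real.log (v x)|).Finite := by
  refine (FinitePlace.hasFiniteMulSupport hx).subset ?_
  intro v hv
  simp only [Function.mem_support, Function.mem_mulSupport] at hv ⊢
  intro h
  simp [h] at hv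

theorem heightIn_nonneg (x : K) : 0 ≤ heightIn K x := by
  unfold heightIn localSum
  have : 0 ≤ ∑ᶠ v : FinitePlace K, |Real.log (v x)| := finsum_nonneg fun _ => abs_nonneg _
  positivity

theorem heightIn_inv (x : K) : heightIn K x⁻¹ = heightIn K x := by
  simp [heightIn, localSum, map_inv₀, Real.log_inv]

theorem heightIn_pow (x : K) (n : ℕ) : heightIn K (x ^ n) = n * heightIn K x := by
  have h1 : ∀ v : FinitePlace K, |Real.log (v (x ^ n))| = (n : ℝ) • |Real.log (v x)| := fun v => by
    simp [map_pow, Real.log_pow, abs_mul]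
  have h2 : ∀ v : InfinitePlace K,
      (v.mult : ℝ) * |Real.log (v (x ^ n))| = n * (v.mult * |Real.log (v x)|) := fun v => by
    simp [map_pow, Real.log_pow, abs_mul]; ring
  simp only [heightIn, localSum, h1, h2, ← Finset.mul_sum]
  rw [← smul_finsum, smul_eq_mul]
  ring

theorem heightIn_mul_le {x y : K} (hx : x ≠ 0) (hy : y ≠ 0) :
    heightIn K (x * y) ≤ heightIn K x + heightIn K y := by
  unfold heightIn
  rw [← add_div]
  gcongr
  unfold localSum
  have e : ∑ᶠ v : FinitePlace K, |Real.log (v (x * y))| ≤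
      ∑ᶠ v : FinitePlace K, |Real.log (v x)| + ∑ᶠ v : FinitePlace K, |Real.log (v y)| := by
    rw [← finsum_add_distrib (finite_support_log hx) (finite_support_log hy)]
    refine finsum_le_finsum' (finite_support_log (mul_ne_zero hx hy)) ?_ ?_
    · exact ((finite_support_log hx).union (finite_support_log hy)).subset
        (Function.support_add _ _)
    · intro v
      simp only [map_mul]
      rw [Real.log_mul (by simpa using hx) (by simpa using hy)]
      exact abs_add_le _ _
  have e2 : ∑ v : InfinitePlace K, (v.mult : ℝ) * |Real.log (v (x * y))| ≤
      ∑ v : InfinitePlace K, (v.mult : ℝ) * |Real.log (v x)| +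
      ∑ v : InfinitePlace K, (v.mult : ℝ) * |Real.log (v y)| := by
    rw [← Finset.sum_add_distrib]
    refine Finset.sum_le_sum fun v _ => ?_
    rw [map_mul, Real.log_mul (by simpa using hx) (by simpa using hy), ← mul_add]
    gcongr
    exact abs_add_le _ _
  linarith

/-- The archimedean part of the height as a sum over complex embeddings. -/
theorem arch_eq (x : K) : ∑ v : InfinitePlace K, (v.mult : ℝ) * |Real.log (v x)| =
    ∑ φ : K →+* ℂ, |Real.log ‖φ x‖| := by
  classical
  rw [← Finset.univ.sum_fiberwise (fun φ : K →+* ℂ => InfinitePlace.mk φ)]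
  refine Finset.sum_congr rfl fun v _ => ?_
  rw [Finset.sum_congr rfl (g := fun _ => |Real.log (v x)|), Finset.sum_const,
    InfinitePlace.card_filter_mk_eq, nsmul_eq_mul]
  intro φ hφ
  rw [← (Finset.mem_filter.mp hφ).2]; rfl

/-- The non-archimedean part of the height through ideal norms. -/
theorem fin_eq {a b : 𝓞 K} (ha : a ≠ 0) (hb : b ≠ 0) :
    ∑ᶠ v : FinitePlace K, |Real.log (v ((a : K) / b))| =
      Real.log (Ideal.absNorm (Ideal.span {a})) + Real.log (Ideal.absNorm (Ideal.span {b})) -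
      2 * Real.log (Ideal.absNorm (Ideal.span {a, b})) := by
  have key : ∀ {ι : Type} [Finite ι] [Nonempty ι] (x : ι → 𝓞 K), (∀ i, x i ≠ 0) →
      Real.log (Ideal.absNorm (Ideal.span (Set.range x))) =
        - ∑ᶠ v : FinitePlace K, Real.log (⨆ i, v (x i)) := by
    intro ι _ _ x hx
    have hx' : x ≠ 0 := fun h => hx (Classical.arbitrary ι) (by simp [h])
    have h := absNorm_mul_finprod_finitePlace_eq_one hx'
    have hpos : ∀ v : FinitePlace K, 0 < ⨆ i, v (x i) := fun v =>
      lt_of_lt_of_le (FinitePlace.pos_iff.mpr (by simpa using hx (Classical.arbitrary ι)))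
        (le_ciSup (f := fun i => v (x i)) (Set.finite_range _).bddAbove (Classical.arbitrary ι))
    have hne : (Ideal.absNorm (Ideal.span (Set.range x)) : ℝ) ≠ 0 := by
      intro h0; rw [h0] at h; simp at h
    have h2 := congrArg Real.log h
    rw [Real.log_mul hne (by intro h0; rw [h0] at h; simp at h), Real.log_finprod hpos,
      Real.log_one] at h2
    linarith
  have hv : ∀ (v : FinitePlace K) {c : 𝓞 K}, c ≠ 0 → 0 < v c := fun v c hc =>
    FinitePlace.pos_iff.mpr (by simpa using hc)
  have ka := key (fun _ : Unit => a) fun _ => ha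
  have kb := key (fun _ : Unit => b) fun _ => hb
  have kab := key ![a, b] (by intro i; fin_cases i <;> simpa)
  have hsup : ∀ v : FinitePlace K, ⨆ i, v (((![a, b] : Fin 2 → 𝓞 K) i : 𝓞 K) : K) =
      max (v a) (v b) := fun v => by
    rw [max_comm]
    apply le_antisymm
    · exact ciSup_le fun i => by fin_cases i <;> simp
    · refine max_le ?_ ?_
      · exact le_ciSup (f := fun i => v (((![a, b] : Fin 2 → 𝓞 K) i : 𝓞 K) : K))
          (Set.finite_range _).bddAbove 1
      · exact le_ciSup (f := fun i => v (((![a, b] : Fin 2 → 𝓞 K) i : 𝓞 K) : K))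
          (Set.finite_range _).bddAbove 0
  simp only [Set.range_const, ciSup_const, hsup, Matrix.range_cons, Matrix.range_empty,
    Set.union_empty, Set.singleton_union] at ka kb kab
  have fs : ∀ {c : 𝓞 K}, c ≠ 0 →
      (Function.support fun v : FinitePlace K => Real.log (v c)).Finite := fun {c} hc => by
    refine (finite_support_log (x := (c : K)) (by simpa using hc)).subset fun v hv => ?_
    simpa using hv
  have fm : (Function.support fun v : FinitePlace K => Real.log (max (v a) (v b))).Finite := by
    refine ((fs ha).union (fs hb)).subset fun v hv => ?_
    rcases le_total (v a) (v b) with h | h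
    · right; simpa [max_eq_right h] using hv
    · left; simpa [max_eq_left h] using hv
  rw [ka, kb, kab]
  have hpt : ∀ v : FinitePlace K, |Real.log (v ((a : K) / b))| =
      (Real.log (max (v a) (v b)) + Real.log (max (v a) (v b))) -
        (Real.log (v a) + Real.log (v b)) := fun v => by
    rw [map_div₀, Real.log_div (hv v ha).ne' (hv v hb).ne']
    rcases le_total (v a) (v b) with h | h
    · have := Real.log_le_log (hv v ha) h
      rw [max_eq_right h, abs_of_nonpos (by linarith)]; ring
    · have := Real.log_le_log (hv v hb) h
      rw [max_eq_left h, abs_of_nonneg (by linarith)]; ring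
  simp only [hpt]
  rw [finsum_sub_distrib ((fm.union fm).subset (Function.support_add _ _))
    (((fs ha).union (fs hb)).subset (Function.support_add _ _)), finsum_add_distrib fm fm,
    finsum_add_distrib (fs ha) (fs hb)]
  ring

end
section
variable {K L : Type*} [Field K] [NumberField K] [Field L] [NumberField L] [Algebra K L]

/-- The height does not depend on the number field in which it is computed. -/
theorem heightIn_algebraMap {x : K} (hx : x ≠ 0) :
    heightIn L (algebraMap K L x) = heightIn K x := by
  have hL : (0 : ℝ) < Module.finrank ℚ L := mod_cast Module.finrank_pos
  have hK : (0 : ℝ) < Module.finrank ℚ K := mod_cast Module.finrank_pos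
  have hd : (Module.finrank ℚ K : ℝ) * Module.finrank K L = Module.finrank ℚ L :=
    mod_cast Module.finrank_mul_finrank ℚ K L
  suffices localSum L (algebraMap K L x) = Module.finrank K L * localSum K x by
    unfold heightIn
    have hKL : (Module.finrank K L : ℝ) ≠ 0 := by
      intro h; rw [← hd, h] at hL; simp at hL
    rw [this, ← hd]
    field_simp
  unfold localSum
  rw [mul_add]
  congr 1
  · rw [arch_eq, arch_eq]
    classical
    rw [← Finset.univ.sum_fiberwise (fun φ : L →+* ℂ => φ.comp (algebraMap K L)), Finset.mul_sum]
    refine Finset.sum_congr rfl fun ψ _ => ?_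
    rw [Finset.sum_congr rfl (g := fun _ => |Real.log ‖ψ x‖|), Finset.sum_const, nsmul_eq_mul]
    · congr 2
      let _ := ψ.toAlgebra
      rw [← AlgHom.card K L ℂ, ← Fintype.card_coe]
      refine Fintype.card_congr
        { toFun := fun φ => { φ.1 with
            commutes' := fun r => RingHom.congr_fun (Finset.mem_filter.mp φ.2).2 r }
          invFun := fun φ => ⟨φ.toRingHom, by
            simp only [Finset.mem_filter, Finset.mem_univ, true_and]
            exact RingHom.ext fun r => φ.commutes r⟩
          left_inv := fun _ => rfl
          right_inv := fun _ => rfl }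
    · intro φ hφ
      rw [← (Finset.mem_filter.mp hφ).2]; rfl
  · obtain ⟨a, b, hb, rfl⟩ := IsFractionRing.div_surjective (A := 𝓞 K) x
    have hb0 : b ≠ 0 := nonZeroDivisors.ne_zero hb
    have ha0 : a ≠ 0 := by rintro rfl; simp at hx
    have hinj : Function.Injective (algebraMap (𝓞 K) (𝓞 L)) :=
      FaithfulSMul.algebraMap_injective _ _
    have hne : ∀ {c : 𝓞 K}, c ≠ 0 → algebraMap (𝓞 K) (𝓞 L) c ≠ 0 := fun hc =>
      (map_ne_zero_iff _ hinj).mpr hc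
    have e1 := fin_eq (hne ha0) (hne hb0)
    have e2 := fin_eq ha0 hb0
    have hN : ∀ I : Ideal (𝓞 K), Real.log (Ideal.absNorm (I.map (algebraMap (𝓞 K) (𝓞 L)))) =
        Module.finrank K L * Real.log (Ideal.absNorm I) := fun I => by
      rw [Ideal.absNorm_algebraMap, Nat.cast_pow, Real.log_pow,
        IsFractionRing.finrank_eq (𝓞 K) K (𝓞 L) L]
    have na := hN (Ideal.span {a})
    have nb := hN (Ideal.span {b})
    have nab := hN (Ideal.span {a, b})
    simp only [Ideal.map_span, Set.image_singleton, Set.image_pair] at na nb nab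
    rw [na, nb, nab] at e1
    rw [map_div₀]
    refine Eq.trans e1 ?_
    rw [show (∑ᶠ v : FinitePlace K, |Real.log (v (algebraMap (𝓞 K) K a / algebraMap (𝓞 K) K b))|)
      = _ from e2]
    ring

end

/-- The fixed algebraic closure of `ℚ`. -/
abbrev Qbar : Type := AlgebraicClosure ℚ

instance isAlgebraic_Qbar : Algebra.IsAlgebraic ℚ Qbar := by
  have h := AlgebraicClosure.isAlgebraic ℚ
  convert h
  · rfl
  · exact Subsingleton.elim _ _

instance numberField (F : IntermediateField ℚ Qbar) [FiniteDimensional ℚ F] : NumberField F where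

instance finiteDimensional_adjoin (x : Qbar) : FiniteDimensional ℚ (IntermediateField.adjoin ℚ {x}) :=
  IntermediateField.adjoin.finiteDimensional (Algebra.IsIntegral.isIntegral x)

/-- The `L¹` Weil height of an algebraic number, computed in `ℚ(x)`. -/
def weilHeight (x : Qbar) : ℝ :=
  heightIn (IntermediateField.adjoin ℚ {x}) (IntermediateField.AdjoinSimple.gen ℚ x)

/-- The height may be computed in any number field containing the number. -/
theorem weilHeight_eq (F : IntermediateField ℚ Qbar) [FiniteDimensional ℚ F] {x : F} (hx : x ≠ 0) :
    weilHeight (x : Qbar) = heightIn F x := by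
  have hle : IntermediateField.adjoin ℚ {(x : Qbar)} ≤ F :=
    IntermediateField.adjoin_simple_le_iff.mpr x.2
  let _ := (IntermediateField.inclusion hle).toRingHom.toAlgebra
  have h0 : IntermediateField.AdjoinSimple.gen ℚ (x : Qbar) ≠ 0 := by
    intro h
    apply hx
    have := congrArg Subtype.val h
    simpa using this
  exact (heightIn_algebraMap (L := F) h0).symm

theorem weilHeight_nonneg (x : Qbar) : 0 ≤ weilHeight x := heightIn_nonneg _

theorem weilHeight_mul_le (x y : Qbarˣ) :
    weilHeight ((x * y : Qbarˣ) : Qbar) ≤ weilHeight x + weilHeight y := by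
  let F := IntermediateField.adjoin ℚ {(x : Qbar)} ⊔ IntermediateField.adjoin ℚ {(y : Qbar)}
  have mx : (x : Qbar) ∈ F := (le_sup_left : _ ≤ F) (IntermediateField.mem_adjoin_simple_self ℚ _)
  have my : (y : Qbar) ∈ F := (le_sup_right : _ ≤ F) (IntermediateField.mem_adjoin_simple_self ℚ _)
  have nx : (⟨x, mx⟩ : F) ≠ 0 := fun h => x.ne_zero (congrArg Subtype.val h)
  have ny : (⟨y, my⟩ : F) ≠ 0 := fun h => y.ne_zero (congrArg Subtype.val h)
  have := heightIn_mul_le nx ny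
  rw [← weilHeight_eq F nx, ← weilHeight_eq F ny, ← weilHeight_eq F (mul_ne_zero nx ny)] at this
  exact this

theorem weilHeight_inv (x : Qbarˣ) : weilHeight ((x⁻¹ : Qbarˣ) : Qbar) = weilHeight x := by
  let F := IntermediateField.adjoin ℚ {(x : Qbar)}
  have mx : (x : Qbar) ∈ F := IntermediateField.mem_adjoin_simple_self ℚ _
  have nx : (⟨x, mx⟩ : F) ≠ 0 := fun h => x.ne_zero (congrArg Subtype.val h)
  have := heightIn_inv (⟨x, mx⟩ : F)
  rw [← weilHeight_eq F nx, ← weilHeight_eq F (inv_ne_zero nx)] at this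
  simpa using this

theorem weilHeight_pow (x : Qbarˣ) (n : ℕ) :
    weilHeight ((x ^ n : Qbarˣ) : Qbar) = n * weilHeight x := by
  let F := IntermediateField.adjoin ℚ {(x : Qbar)}
  have mx : (x : Qbar) ∈ F := IntermediateField.mem_adjoin_simple_self ℚ _
  have nx : (⟨x, mx⟩ : F) ≠ 0 := fun h => x.ne_zero (congrArg Subtype.val h)
  have := heightIn_pow (⟨x, mx⟩ : F) n
  rw [← weilHeight_eq F nx, ← weilHeight_eq F (pow_ne_zero n nx)] at this
  simpa using this

theorem weilHeight_one : weilHeight ((1 : Qbarˣ) : Qbar) = 0 := by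
  simpa using weilHeight_pow 1 0

theorem weilHeight_torsion {x : Qbarˣ} (hx : x ∈ CommGroup.torsion Qbarˣ) :
    weilHeight (x : Qbar) = 0 := by
  obtain ⟨n, hn, h⟩ := isOfFinOrder_iff_pow_eq_one.mp hx
  have := weilHeight_pow x n
  rw [h, weilHeight_one] at this
  have hn' : (n : ℝ) ≠ 0 := by positivity
  simpa [hn', eq_comm] using this

/- ### Algebraic numbers modulo torsion -/

/-- Nonzero algebraic numbers modulo roots of unity, written additively: the product of classes is
`+` and the power `a ^ r` with `r : ℚ` is `r • a`. -/
def AlgModTorsion : Type := Additive (Qbarˣ ⧸ CommGroup.torsion Qbarˣ)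

namespace AlgModTorsion

instance : AddCommGroup AlgModTorsion :=
  inferInstanceAs (AddCommGroup (Additive (Qbarˣ ⧸ CommGroup.torsion Qbarˣ)))

/-- The class of a nonzero algebraic number modulo roots of unity. -/
def cls (x : Qbarˣ) : AlgModTorsion := Additive.ofMul (QuotientGroup.mk x)

theorem cls_surjective : Function.Surjective cls := QuotientGroup.mk_surjective

theorem cls_eq_iff {x y : Qbarˣ} : cls x = cls y ↔ x⁻¹ * y ∈ CommGroup.torsion Qbarˣ :=
  QuotientGroup.eq

theorem cls_mul (x y : Qbarˣ) : cls (x * y) = cls x + cls y := rfl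
theorem cls_inv (x : Qbarˣ) : cls x⁻¹ = -cls x := rfl
theorem cls_one : cls 1 = 0 := rfl
theorem cls_pow (x : Qbarˣ) (n : ℕ) : cls (x ^ n) = n • cls x := rfl
theorem cls_zpow (x : Qbarˣ) (n : ℤ) : cls (x ^ n) = n • cls x := rfl

theorem nsmul_injective {n : ℕ} (hn : n ≠ 0) : Function.Injective fun a : AlgModTorsion => n • a :=
  fun a b h => by
    exact (pow_left_injective (M := Qbarˣ ⧸ CommGroup.torsion Qbarˣ) hn) h

theorem nsmul_surjective {n : ℕ} (hn : n ≠ 0) : Function.Surjective fun a : AlgModTorsion => n • a := by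
  intro a
  obtain ⟨x, rfl⟩ := cls_surjective a
  obtain ⟨z, hz⟩ := IsAlgClosed.exists_pow_nat_eq (x : Qbar) (Nat.pos_of_ne_zero hn)
  have hz0 : z ≠ 0 := by
    rintro rfl
    rw [zero_pow hn] at hz
    exact x.ne_zero hz.symm
  refine ⟨cls (Units.mk0 z hz0), ?_⟩
  change cls (Units.mk0 z hz0 ^ n) = _
  congr 1
  ext
  simpa using hz

/-- The unique solution `b` of `n • b = a`, for `n ≠ 0`. -/
def divNat (n : ℕ) (a : AlgModTorsion) : AlgModTorsion := if hn : n ≠ 0 then (nsmul_surjective hn a).choose else 0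

theorem nsmul_divNat {n : ℕ} (hn : n ≠ 0) (a : AlgModTorsion) : n • divNat n a = a := by
  rw [divNat, dif_pos hn]
  exact (nsmul_surjective hn a).choose_spec

instance : SMul ℚ AlgModTorsion := ⟨fun q a => divNat q.den (q.num • a)⟩

theorem den_smul (q : ℚ) (a : AlgModTorsion) : q.den • (q • a) = q.num • a := nsmul_divNat q.den_nz _

theorem eq_smul_iff {q : ℚ} {n : ℕ} {m : ℤ} (hn : n ≠ 0) (h : q * n = m) {a b : AlgModTorsion} :
    b = q • a ↔ n • b = m • a := by
  have hq : q.num * n = m * q.den := by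
    have h1 : (q.num : ℚ) = q * q.den := (Rat.mul_den_eq_num q).symm
    have : (q.num : ℚ) * n = m * q.den := by rw [h1, ← h]; ring
    exact_mod_cast this
  have e : q.den • (n • (q • a)) = q.den • (m • a) := by
    rw [smul_comm, den_smul, ← natCast_zsmul, ← natCast_zsmul, smul_smul, smul_smul]
    congr 1
    linarith
  constructor
  · rintro rfl
    exact nsmul_injective q.den_nz e
  · intro hb
    apply nsmul_injective hn
    refine hb.trans ?_
    exact (nsmul_injective q.den_nz e).symm

instance : Module ℚ AlgModTorsion where
  one_smul a := ((eq_smul_iff (n := 1) (m := 1) one_ne_zero (by simp)).mpr (by simp)).symm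
  mul_smul q r a := by
    refine ((eq_smul_iff (n := q.den * r.den) (m := q.num * r.num)
      (mul_ne_zero q.den_nz r.den_nz) ?_).mpr ?_).symm
    · push_cast
      rw [← Rat.mul_den_eq_num q, ← Rat.mul_den_eq_num r]; ring
    · rw [mul_comm q.den, mul_smul, den_smul, smul_comm, den_smul, smul_smul]
  smul_zero q := ((eq_smul_iff q.den_nz (Rat.mul_den_eq_num q)).mpr (by simp)).symm
  smul_add q a b := by
    refine ((eq_smul_iff q.den_nz (Rat.mul_den_eq_num q)).mpr ?_).symm
    rw [smul_add, den_smul, den_smul, smul_add]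
  add_smul q r a := by
    refine ((eq_smul_iff (n := q.den * r.den) (m := q.num * r.den + r.num * q.den)
      (mul_ne_zero q.den_nz r.den_nz) ?_).mpr ?_).symm
    · push_cast
      rw [← Rat.mul_den_eq_num q, ← Rat.mul_den_eq_num r]; ring
    · rw [smul_add, mul_smul, mul_smul, den_smul, smul_comm q.den r.den (q • a), den_smul, add_smul,
        ← natCast_zsmul, ← natCast_zsmul, smul_smul, smul_smul, mul_comm q.num, mul_comm r.num]
  zero_smul a := ((eq_smul_iff (n := 1) (m := 0) one_ne_zero (by simp)).mpr (by simp)).symm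

/-- The `L¹` Weil height on classes modulo roots of unity. -/
def h₁ (a : AlgModTorsion) : ℝ :=
  Quotient.lift (s := QuotientGroup.leftRel (CommGroup.torsion Qbarˣ))
    (fun x : Qbarˣ => weilHeight (x : Qbar)) (by
      intro x y hxy
      have ht : x⁻¹ * y ∈ CommGroup.torsion Qbarˣ := QuotientGroup.leftRel_apply.mp hxy
      have h1 := weilHeight_mul_le x (x⁻¹ * y)
      have h2 := weilHeight_mul_le y (x⁻¹ * y)⁻¹
      rw [weilHeight_torsion ht, mul_inv_cancel_left] at h1
      rw [weilHeight_torsion (inv_mem ht), mul_inv_rev, inv_inv, mul_inv_cancel_left] at h2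
      exact le_antisymm (by linarith) (by linarith)) a

theorem h₁_cls (x : Qbarˣ) : h₁ (cls x) = weilHeight (x : Qbar) := rfl

/-- `h₁` is a seminorm (in fact a norm) on the additive group of classes. -/
def heightSeminorm : AddGroupSeminorm AlgModTorsion where
  toFun := h₁
  map_zero' := weilHeight_one
  add_le' a b := by
    obtain ⟨x, rfl⟩ := cls_surjective a
    obtain ⟨y, rfl⟩ := cls_surjective b
    exact weilHeight_mul_le x y
  neg' a := by
    obtain ⟨x, rfl⟩ := cls_surjective a
    exact weilHeight_inv x

instance : SeminormedAddCommGroup AlgModTorsion := heightSeminorm.toSeminormedAddCommGroup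

theorem norm_eq (a : AlgModTorsion) : ‖a‖ = h₁ a := rfl

theorem h₁_nsmul (n : ℕ) (a : AlgModTorsion) : h₁ (n • a) = n * h₁ a := by
  obtain ⟨x, rfl⟩ := cls_surjective a
  exact weilHeight_pow x n

theorem h₁_zsmul (n : ℤ) (a : AlgModTorsion) : h₁ (n • a) = |(n : ℝ)| * h₁ a := by
  obtain ⟨m, rfl | rfl⟩ := n.eq_nat_or_neg
  · simp [h₁_nsmul]
  · rw [neg_smul, ← norm_eq, norm_neg, norm_eq]
    simp [h₁_nsmul]

theorem h₁_qsmul (q : ℚ) (a : AlgModTorsion) : h₁ (q • a) = |(q : ℝ)| * h₁ a := by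
  have h := congrArg h₁ (den_smul q a)
  rw [h₁_nsmul, h₁_zsmul] at h
  have hd : (0 : ℝ) < q.den := mod_cast q.den_pos
  have : (q.num : ℝ) = q * q.den := by exact_mod_cast (Rat.mul_den_eq_num q).symm
  rw [this, abs_mul, abs_of_pos hd] at h
  have := mul_left_cancel₀ hd.ne' (h.trans (by ring : _ = (q.den : ℝ) * (|(q : ℝ)| * h₁ a)))
  exact this

instance : NormedSpace ℚ AlgModTorsion where
  norm_smul_le q a := by
    rw [norm_eq, norm_eq, h₁_qsmul, ← Rat.norm_cast_real, Real.norm_eq_abs]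

end AlgModTorsion
open AlgModTorsion

/- ### The completion -/

/-- The completion of the space of classes with respect to `h₁`. Its norm is the continuous extension
of `h₁`. -/
abbrev CompletedSpace : Type := UniformSpace.Completion AlgModTorsion

namespace CompletedSpace

/-- Rational scalars acting on the completion. -/
def ratScalar : ℚ →+* (CompletedSpace →L[ℚ] CompletedSpace) := algebraMap ℚ (CompletedSpace →L[ℚ] CompletedSpace)

theorem ratScalar_uniformContinuous : UniformContinuous ratScalar :=
  (algebraMapCLM ℚ (CompletedSpace →L[ℚ] CompletedSpace)).uniformContinuous

/-- Real scalars acting on the completion, by continuity from the rational ones. -/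
def realScalar : ℝ →+* (CompletedSpace →L[ℚ] CompletedSpace) :=
  IsDenseInducing.extendRingHom (i := Rat.castHom ℝ) (f := ratScalar)
    Rat.isUniformEmbedding_coe_real.isUniformInducing Rat.denseRange_cast
    ratScalar_uniformContinuous

theorem realScalar_continuous : Continuous realScalar :=
  (uniformContinuous_uniformly_extend Rat.isUniformEmbedding_coe_real.isUniformInducing
    Rat.denseRange_cast ratScalar_uniformContinuous).continuous

theorem realScalar_ratCast (q : ℚ) : realScalar (q : ℝ) = ratScalar q :=
  IsDenseInducing.extend_eq
    (Rat.isUniformEmbedding_coe_real.isUniformInducing.isDenseInducing Rat.denseRange_cast)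
    ratScalar_uniformContinuous.continuous q

instance : SMul ℝ CompletedSpace := ⟨fun r x => realScalar r x⟩

theorem smul_def (r : ℝ) (x : CompletedSpace) : r • x = realScalar r x := rfl

theorem continuous_smul_left (x : CompletedSpace) : Continuous fun r : ℝ => r • x :=
  (ContinuousLinearMap.apply ℚ CompletedSpace x).continuous.comp realScalar_continuous

theorem ratCast_smul (q : ℚ) (x : CompletedSpace) : (q : ℝ) • x = q • x := by
  rw [smul_def, realScalar_ratCast]; rfl

instance : Module ℝ CompletedSpace where
  one_smul x := by simp [smul_def]
  mul_smul r s x := by simp [smul_def]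
  smul_zero r := by simp [smul_def]
  smul_add r x y := by simp [smul_def]
  add_smul r s x := by simp [smul_def]
  zero_smul x := by simp [smul_def]

instance : NormedSpace ℝ CompletedSpace where
  norm_smul_le r x := by
    refine le_of_eq ?_
    refine Rat.denseRange_cast.induction_on (p := fun r : ℝ => ‖r • x‖ = ‖r‖ * ‖x‖) r ?_ ?_
    · exact isClosed_eq (continuous_smul_left x).norm (by fun_prop)
    · intro q
      rw [ratCast_smul, norm_smul, Rat.norm_cast_real]

end CompletedSpace

/- ### Subspaces attached to number fields -/

/-- The space `V_F`: the `ℚ`-subspace spanned by the classes of the nonzero elements of `F`. -/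
def fieldSpace (F : IntermediateField ℚ Qbar) : Submodule ℚ AlgModTorsion :=
  Submodule.span ℚ {a | ∃ x : Qbarˣ, (x : Qbar) ∈ F ∧ a = cls x}

/-- The places of `ℚ`: the rational primes, and the archimedean place `⊤`. -/
abbrev RatPlace : Type := WithTop Nat.Primes

/-- The absolute value `w` is a place of `F` lying over the given place of `ℚ`. -/
def LiesOver {F : Type*} [Field F] [NumberField F] (w : AbsoluteValue F ℝ) : RatPlace → Prop
  | ⊤ => IsInfinitePlace w
  | (p : Nat.Primes) => IsFinitePlace w ∧ w (p : ℕ) < 1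

/-- `‖a‖_w = 1` for a class `a` in `V_F`. Such a class has a multiple `n • a`, `n ≠ 0`, represented by
some `x` in `F`, and `‖a‖_w = 1` if and only if `w x = 1`, whichever `n` and `x` are used. -/
def TrivialAt {F : IntermediateField ℚ Qbar} (w : AbsoluteValue F ℝ) (a : AlgModTorsion) : Prop :=
  ∃ n : ℕ, n ≠ 0 ∧ ∃ (x : Qbarˣ) (hx : (x : Qbar) ∈ F), n • a = cls x ∧ w ⟨x, hx⟩ = 1

/-- The space `V_{F,S}` of the classes `a` in `V_F` with `‖a‖_w = 1` for every place `w` of `F` that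
does not lie over an element of `S`. -/
def sUnitSpace (F : IntermediateField ℚ Qbar) [FiniteDimensional ℚ F] (S : Finset RatPlace) :
    Submodule ℚ AlgModTorsion where
  carrier := {a | a ∈ fieldSpace F ∧ ∀ (p : RatPlace) (w : AbsoluteValue F ℝ), p ∉ S → LiesOver w p →
    TrivialAt w a}
  zero_mem' := ⟨zero_mem _, fun p w _ _ => ⟨1, one_ne_zero, 1, one_mem F, by simp [cls_one],
    map_one w⟩⟩
  add_mem' := by
    rintro a b ⟨ha, ha'⟩ ⟨hb, hb'⟩
    refine ⟨add_mem ha hb, fun p w hp hw => ?_⟩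
    obtain ⟨n, hn, x, hx, hax, hwx⟩ := ha' p w hp hw
    obtain ⟨m, hm, y, hy, hby, hwy⟩ := hb' p w hp hw
    refine ⟨n * m, mul_ne_zero hn hm, x ^ m * y ^ n, ?_, ?_, ?_⟩
    · rw [Units.val_mul, Units.val_pow_eq_pow_val, Units.val_pow_eq_pow_val]
      exact mul_mem (pow_mem hx m) (pow_mem hy n)
    · rw [cls_mul, cls_pow, cls_pow, ← hax, ← hby, smul_add, smul_smul, smul_smul, mul_comm m n]
    · have : (⟨((x ^ m * y ^ n : Qbarˣ) : Qbar), by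
          rw [Units.val_mul, Units.val_pow_eq_pow_val, Units.val_pow_eq_pow_val]
          exact mul_mem (pow_mem hx m) (pow_mem hy n)⟩ : F) = ⟨x, hx⟩ ^ m * ⟨y, hy⟩ ^ n := by
        ext; simp
      rw [this, map_mul, map_pow, map_pow, hwx, hwy]; simp
  smul_mem' := by
    rintro q a ⟨ha, ha'⟩
    refine ⟨Submodule.smul_mem _ q ha, fun p w hp hw => ?_⟩
    obtain ⟨n, hn, x, hx, hax, hwx⟩ := ha' p w hp hw
    have hxm : ((x ^ q.num : Qbarˣ) : Qbar) ∈ F := by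
      rw [Units.val_zpow_eq_zpow_val]
      exact zpow_mem hx _
    refine ⟨n * q.den, mul_ne_zero hn q.den_nz, x ^ q.num, hxm, ?_, ?_⟩
    · rw [mul_smul, den_smul, smul_comm, hax, cls_zpow]
    · have : (⟨((x ^ q.num : Qbarˣ) : Qbar), hxm⟩ : F) = ⟨x, hx⟩ ^ q.num := by
        apply Subtype.ext
        refine (Units.val_zpow_eq_zpow_val x q.num).trans ?_
        exact (map_zpow₀ F.val (⟨x, hx⟩ : F) q.num).symm
      rw [this, map_zpow₀, hwx, one_zpow]

/-- The completion of `V_{F,S}` with respect to `h₁`: its closure in the completed space, which is a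
real subspace. -/
def sUnitCompletion (F : IntermediateField ℚ Qbar) [FiniteDimensional ℚ F] (S : Finset RatPlace) :
    Submodule ℝ CompletedSpace where
  carrier := closure ((fun a : AlgModTorsion => (a : CompletedSpace)) '' (sUnitSpace F S : Set AlgModTorsion))
  zero_mem' := subset_closure ⟨0, zero_mem _, UniformSpace.Completion.coe_zero⟩
  add_mem' := by
    intro a b ha hb
    exact ((sUnitSpace F S).map (UniformSpace.Completion.toComplL (𝕜 := ℚ) (E := AlgModTorsion)).toLinearMap
      ).topologicalClosure.add_mem ha hb
  smul_mem' := by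
    intro r a ha
    refine Rat.denseRange_cast.induction_on
      (p := fun r : ℝ => r • a ∈ closure ((fun a : AlgModTorsion => (a : CompletedSpace)) '' (sUnitSpace F S : Set AlgModTorsion))) r ?_ ?_
    · exact isClosed_closure.preimage (CompletedSpace.continuous_smul_left a)
    · intro q
      rw [CompletedSpace.ratCast_smul]
      exact ((sUnitSpace F S).map (UniformSpace.Completion.toComplL (𝕜 := ℚ) (E := AlgModTorsion)).toLinearMap
        ).topologicalClosure.smul_mem q ha

/- ### The extremal norm -/

/-- The least degree over `ℚ` of a representative of the class `a`. -/
def minDegree (a : AlgModTorsion) : ℕ :=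
  sInf {n | ∃ x : Qbarˣ, cls x = a ∧ n = Module.finrank ℚ (IntermediateField.adjoin ℚ {(x : Qbar)})}

/-- The minimal logarithmic `L¹` Mahler measure of a class. -/
def mahler₁ (a : AlgModTorsion) : ℝ := minDegree a * h₁ a

/-- The norm height associated to `f`: the infimum of `∑ |r_i| f(b_i)` over all ways of writing `a`
as a finite `ℚ`-linear combination `∑ r_i • b_i`. -/
def normHeight (f : AlgModTorsion → ℝ) (a : AlgModTorsion) : ℝ :=
  sInf {s | ∃ (n : ℕ) (r : Fin n → ℚ) (b : Fin n → AlgModTorsion),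
    a = ∑ i, r i • b i ∧ s = ∑ i, |(r i : ℝ)| * f (b i)}

/-- The extremal norm associated to the minimal `L¹` Mahler measure. -/
def extremalNorm₁ : AlgModTorsion → ℝ := normHeight mahler₁

/- ### The finite set of subfields of a number field -/

instance finiteDimensional_of_mem_Iic (K : IntermediateField ℚ Qbar) [FiniteDimensional ℚ K]
    (F : Set.Iic K) : FiniteDimensional ℚ F.1 :=
  Module.Finite.of_injective (IntermediateField.inclusion F.2).toLinearMap
    (IntermediateField.inclusion_injective F.2)

instance finite_Iic (K : IntermediateField ℚ Qbar) [FiniteDimensional ℚ K] : Finite (Set.Iic K) :=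
  let _ : Algebra ℚ K := K.algebra'
  have : Finite (IntermediateField ℚ K) :=
    Field.finite_intermediateField_of_exists_primitive_element ℚ K
      (Field.exists_primitive_element ℚ K)
  Finite.of_injective (fun F : Set.Iic K => IntermediateField.restrict F.2) fun E F h => by
    apply Subtype.ext
    rw [← IntermediateField.lift_restrict E.2, ← IntermediateField.lift_restrict F.2]
    exact congrArg _ h

instance fintype_Iic (K : IntermediateField ℚ Qbar) [FiniteDimensional ℚ K] : Fintype (Set.Iic K) :=
  Fintype.ofFinite _

end WeilHeight

end

open WeilHeight

/-! The infimum defining $\widetilde m_1(\alpha)$ is reduced, without increasing the cost, to a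
minimum over a finite-dimensional real space. The minimum is then attained by compactness, and a
tie-break among minimisers gives the orthogonality-like last condition.

Descent to subfields of $K$ (`exists_subfield_decomposition`). Let $x$ be a representative of least
degree and $L=\mathbb Q(x)$. Averaging over $\mathrm{Gal}(N/K)$, with $N$ normal and large, fixes
$\alpha$ and does not increase $h_1$. Since $K$ is normal, it sends the class of $x$ into $V_{K\cap
L}$, and $[K\cap L:\mathbb Q]\le[L:\mathbb Q]$. So only sums $\alpha=\sum_F\beta_F$ with $\beta_F\in
V_F$ and cost $\sum_F[F:\mathbb Q]h_1(\beta_F)$ matter.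

Descent to $S$ (`mem_logSpan_iff`, `sum_abs_truncate_le`). Choose $S$ so that $\alpha$ is an
$S$-unit class. By Dirichlet's theorem and finiteness of the class group, the logarithm vectors of
$V_{F,S}$ span over $\mathbb R$ all zero-sum $\mathrm{Gal}(K/F)$-invariant vectors supported over
$S$. A vector from $V_F$ may therefore be cut off outside $S$ and its defect spread evenly over the
infinite places. By the product formula this does not increase the $\ell^1$ norm, and it leaves
$\alpha$ unchanged. `exists_realization` identifies these vectors with elements of the completion.

Optimality (`exists_optimal`). Among the minimisers of $\sum_F[F:\mathbb Q]\,\|t_F\|$ take one that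
minimises $\sum_F[F:\mathbb Q]^2\|t_F\|$. Suppose $t_F$ could be shortened by an element of the
space of some $E\subsetneq F$. Then by `exists_l1_descent` it can be shortened by a nonzero $\beta'$
with $[E:\mathbb Q]\,\|\beta'\|\le[F:\mathbb Q](\|t_F\|-\|t_F-\beta'\|)$. Moving $\beta'$ from $F$
to $E$ does not raise the first cost and strictly lowers the second, a contradiction. The rate comes
from integrality: the slopes of the $\ell^1$ norm along $\mathrm{Gal}(K/E)$-orbits count group
elements, and $\mathrm{Gal}(K/F)$-invariance makes these counts multiples of $|\mathrm{Gal}(K/F)|$.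
-/

open NumberField
noncomputable section
namespace WeilHeight
open IsDedekindDomain AlgModTorsion

/-! ### Shortening invariant vectors in the $\ell^1$ norm. -/

section L1
variable {X G : Type*} [Fintype X] [Group G] [Fintype G] [MulAction G X]

/-- A finite set stable under left multiplication by `H` has cardinality divisible by `|H|`. -/
theorem card_dvd_of_mul_left_stable (H : Subgroup G) (s : Finset G)
    (hs : ∀ h ∈ H, ∀ g ∈ s, h * g ∈ s) : Nat.card H ∣ s.card := by
  classical
  let q : G → Quotient (QuotientGroup.rightRel H) := Quotient.mk _
  rw [Finset.card_eq_sum_card_image q s]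
  refine Finset.dvd_sum fun b hb => ?_
  obtain ⟨g, hg, rfl⟩ := Finset.mem_image.mp hb
  have : (s.filter fun x => q x = q g) = Finset.univ.image fun h : H => (h : G) * g := by
    ext x
    simp only [Finset.mem_filter, Finset.mem_image, Finset.mem_univ, true_and]
    constructor
    · rintro ⟨-, hx⟩
      have : g * x⁻¹ ∈ H := QuotientGroup.rightRel_apply.mp (Quotient.exact hx)
      exact ⟨⟨x * g⁻¹, by simpa using H.inv_mem this⟩, by simp⟩
    · rintro ⟨h, rfl⟩
      refine ⟨hs h h.2 g hg, Quotient.sound (QuotientGroup.rightRel_apply.mpr ?_)⟩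
      simp
  rw [this, Finset.card_image_of_injective _ fun a b hab => by simpa using hab, Finset.card_univ,
    Nat.card_eq_fintype_card]

/-- If some invariant zero-sum function shortens `f`, then one does so at a definite rate. -/
theorem exists_l1_descent (H : Subgroup G) (f β : X → ℝ) (hf : ∀ h ∈ H, ∀ x, f (h • x) = f x)
    (hβ : ∀ (g : G) x, β (g • x) = β x) (hsum : ∑ x, β x = 0)
    (hlt : ∑ x, |f x - β x| < ∑ x, |f x|) :
    ∃ β' : X → ℝ, (∀ (g : G) x, β' (g • x) = β' x) ∧ ∑ x, β' x = 0 ∧ β' ≠ 0 ∧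
      (Nat.card H : ℝ) * ∑ x, |β' x| ≤ Nat.card G * (∑ x, |f x| - ∑ x, |f x - β' x|) := by
  classical
  -- At $\varepsilon=0^+$ the slope of $\varepsilon\mapsto|t-\varepsilon b|$ is $b\,s(t)$ for $b>0$
  -- and $b\,s'(t)$ for $b\le0$; the two differ only at $t=0$. `R` and `L` sum these slopes over
  -- orbits.
  let s : ℝ → ℝ := fun t => if t ≤ 0 then 1 else -1
  let s' : ℝ → ℝ := fun t => if t < 0 then 1 else -1
  let R : X → ℝ := fun x => ∑ g : G, s (f (g • x))
  let L : X → ℝ := fun x => ∑ g : G, s' (f (g • x))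
  have hG : (0 : ℝ) < Nat.card G := mod_cast Nat.card_pos
  have hH : (0 : ℝ) < Nat.card H := mod_cast Nat.card_pos
  have step1 : ∑ y, β y * (if 0 < β y then R y else L y) < 0 := by
    -- Convexity: the one-sided slope is at most the increment over the whole step.
    have pt : ∀ y, β y * (if 0 < β y then s (f y) else s' (f y)) ≤ |f y - β y| - |f y| := by
      intro y
      simp only [s, s']
      split_ifs <;>
      · rcases abs_cases (f y - β y) with h | h <;> rcases abs_cases (f y) with h' | h' <;> linarith
    have e : ∀ g : G, ∑ y, β y * (if 0 < β y then s (f (g • y)) else s' (f (g • y))) =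
        ∑ y, β y * (if 0 < β y then s (f y) else s' (f y)) := fun g => by
      rw [← Equiv.sum_comp (MulAction.toPerm g)
        fun y => β y * (if 0 < β y then s (f y) else s' (f y))]
      simp only [MulAction.toPerm_apply, hβ]
    have e2 : ∑ y, β y * (if 0 < β y then R y else L y) =
        ∑ g : G, ∑ y, β y * (if 0 < β y then s (f (g • y)) else s' (f (g • y))) := by
      rw [Finset.sum_comm]
      refine Finset.sum_congr rfl fun y _ => ?_
      rw [← Finset.mul_sum]
      split_ifs <;> rfl
    rw [e2, Finset.sum_congr rfl fun g _ => e g, Finset.sum_const, Finset.card_univ, nsmul_eq_mul,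
      ← Nat.card_eq_fintype_card]
    refine mul_neg_of_pos_of_neg hG (lt_of_le_of_lt (Finset.sum_le_sum fun y _ => pt y) ?_)
    rw [Finset.sum_sub_distrib]
    linarith
  -- If $R\ge L$ for every such pair, then the maximum of $L$ over $\{\beta<0\}$ separates the two
  -- families, and $\sum\beta=0$ makes the weighted sum nonnegative.
  obtain ⟨x, x', hx, hx', hRL⟩ : ∃ x x', 0 < β x ∧ β x' < 0 ∧ R x < L x' := by
    by_contra! hno
    have hex : ∃ y, β y < 0 := by
      by_contra! h
      have : ∀ y, β y = 0 := fun y =>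
        (Finset.sum_eq_zero_iff_of_nonneg fun y _ => h y).mp hsum y (Finset.mem_univ y)
      simp [this] at step1
    obtain ⟨y₀, hy₀, hmax⟩ := Finset.exists_max_image (Finset.univ.filter fun y => β y < 0) L
      (by obtain ⟨y, hy⟩ := hex; exact ⟨y, by simpa using hy⟩)
    simp only [Finset.mem_filter, Finset.mem_univ, true_and] at hy₀ hmax
    have : ∑ y, β y * L y₀ ≤ ∑ y, β y * (if 0 < β y then R y else L y) := by
      refine Finset.sum_le_sum fun y _ => ?_
      split_ifs with h
      · exact mul_le_mul_of_nonneg_left (hno y y₀ h hy₀) h.le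
      · rcases (not_lt.mp h).lt_or_eq with h' | h'
        · exact mul_le_mul_of_nonpos_left (hmax y h') h'.le
        · simp [h']
    rw [← Finset.sum_mul, hsum, zero_mul] at this
    linarith
  -- $R(x)$ and $L(x')$ both equal $|G|$ minus twice a cardinality divisible by $|H|$, so a strict
  -- inequality between them is a gap of at least $2|H|$.
  have hgap : R x + 2 * Nat.card H ≤ L x' := by
    have hR : R x = Nat.card G - 2 * ((Finset.univ.filter fun g : G => 0 < f (g • x)).card : ℝ) := by
      have : ∀ g : G, s (f (g • x)) = 1 - 2 * (if 0 < f (g • x) then (1 : ℝ) else 0) := fun g => by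
        simp only [s]
        rcases lt_or_ge 0 (f (g • x)) with h | h
        · rw [if_neg (not_le.mpr h), if_pos h]; norm_num
        · rw [if_pos h, if_neg (not_lt.mpr h)]; norm_num
      simp only [R, this, Finset.sum_sub_distrib, ← Finset.mul_sum, Finset.sum_boole,
        Finset.sum_const, Finset.card_univ, nsmul_eq_mul, mul_one, Nat.card_eq_fintype_card]
    have hL : L x' = Nat.card G -
        2 * ((Finset.univ.filter fun g : G => 0 ≤ f (g • x')).card : ℝ) := by
      have : ∀ g : G, s' (f (g • x')) = 1 - 2 * (if 0 ≤ f (g • x') then (1 : ℝ) else 0) :=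
        fun g => by
        simp only [s']
        rcases le_or_gt 0 (f (g • x')) with h | h
        · rw [if_neg (not_lt.mpr h), if_pos h]; norm_num
        · rw [if_pos h, if_neg (not_le.mpr h)]; norm_num
      simp only [L, this, Finset.sum_sub_distrib, ← Finset.mul_sum, Finset.sum_boole,
        Finset.sum_const, Finset.card_univ, nsmul_eq_mul, mul_one, Nat.card_eq_fintype_card]
    obtain ⟨k, hk⟩ := card_dvd_of_mul_left_stable H
      (Finset.univ.filter fun g : G => 0 < f (g • x)) fun h hh g hg => by
        simpa [mul_smul, hf h hh] using hg
    obtain ⟨l, hl⟩ := card_dvd_of_mul_left_stable H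
      (Finset.univ.filter fun g : G => 0 ≤ f (g • x')) fun h hh g hg => by
        simpa [mul_smul, hf h hh] using hg
    rw [hk] at hR
    rw [hl] at hL
    push_cast at hR hL
    have hlk : l < k := by
      have : (Nat.card H : ℝ) * l < Nat.card H * k := by linarith
      exact_mod_cast lt_of_mul_lt_mul_left this hH.le
    have : (l : ℝ) + 1 ≤ k := mod_cast hlk
    have := mul_le_mul_of_nonneg_left this hH.le
    linarith
  obtain ⟨δ, hδ, hδf⟩ : ∃ δ : ℝ, 0 < δ ∧ ∀ y, f y ≠ 0 → δ ≤ |f y| := by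
    rcases (Finset.univ.filter fun y => f y ≠ 0).eq_empty_or_nonempty with h | h
    · refine ⟨1, one_pos, fun y hy => ?_⟩
      have : y ∈ Finset.univ.filter fun y => f y ≠ 0 := by simpa using hy
      simp [h] at this
    · obtain ⟨y₀, hy₀, hmin⟩ := Finset.exists_min_image _ (fun y => |f y|) h
      simp only [Finset.mem_filter, Finset.mem_univ, true_and] at hy₀ hmin
      exact ⟨|f y₀|, abs_pos.mpr hy₀, hmin⟩
  -- $c_z$ is the indicator of the orbit of $z$ times the order of the stabiliser. The new direction
  -- is a multiple of $c_x-c_{x'}$; the weights make both terms have total mass $|G|$.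
  let c : X → X → ℝ := fun z y => ∑ g : G, if g • z = y then 1 else 0
  have c_nonneg : ∀ z y, 0 ≤ c z y := fun z y => Finset.sum_nonneg fun g _ => by positivity
  have c_le : ∀ z y, c z y ≤ Nat.card G := fun z y => by
    calc c z y ≤ ∑ g : G, (1 : ℝ) := Finset.sum_le_sum fun g _ => by split_ifs <;> norm_num
      _ = _ := by simp
  have c_inv : ∀ z (g : G) y, c z (g • y) = c z y := fun z g y => by
    simp only [c]
    rw [← Equiv.sum_comp (Equiv.mulLeft g)]
    simp [mul_smul]
  have c_sum : ∀ z (u : X → ℝ), ∑ y, c z y * u y = ∑ g : G, u (g • z) := fun z u => by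
    simp only [c, Finset.sum_mul]
    rw [Finset.sum_comm]
    refine Finset.sum_congr rfl fun g _ => ?_
    simp
  -- The orbits of $x$ and $x'$ are disjoint, because $\beta$ is constant on orbits and has opposite
  -- signs at the two points.
  have c_disj : ∀ y, c x y = 0 ∨ c x' y = 0 := fun y => by
    by_contra! h
    obtain ⟨g, -, hg⟩ := Finset.exists_ne_zero_of_sum_ne_zero h.1
    obtain ⟨g', -, hg'⟩ := Finset.exists_ne_zero_of_sum_ne_zero h.2
    have h1 : g • x = y := by by_contra h0; simp [h0] at hg
    have h2 : g' • x' = y := by by_contra h0; simp [h0] at hg'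
    have := hβ g x
    rw [h1, ← h2, hβ] at this
    linarith
  have c_tot : ∀ z, ∑ y, c z y = Nat.card G := fun z => by simpa using c_sum z fun _ => 1
  have c_self : 0 < c x x := by
    refine lt_of_lt_of_le one_pos ?_
    calc (1 : ℝ) = if (1 : G) • x = x then 1 else 0 := by simp
      _ ≤ _ := Finset.single_le_sum (f := fun g : G => if g • x = x then (1 : ℝ) else 0)
        (fun g _ => by positivity) (Finset.mem_univ 1)
  -- With this step no nonzero value of $f$ changes sign, so the $\ell^1$ norm changes exactly by
  -- the slopes.
  let ε := δ / Nat.card G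
  have hε : 0 < ε := div_pos hδ hG
  have hεc : ∀ z y, ε * c z y ≤ δ := fun z y => by
    calc ε * c z y ≤ ε * Nat.card G := mul_le_mul_of_nonneg_left (c_le z y) hε.le
      _ = δ := div_mul_cancel₀ _ hG.ne'
  refine ⟨fun y => ε * (c x y - c x' y), fun g y => by simp only [c_inv], ?_, ?_, ?_⟩
  · rw [← Finset.mul_sum, Finset.sum_sub_distrib, c_tot, c_tot, sub_self, mul_zero]
  · intro h
    have := congrFun h x
    simp only [Pi.zero_apply] at this
    rcases c_disj x with h0 | h0
    · linarith
    · rw [h0, sub_zero] at this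
      exact (mul_pos hε c_self).ne' this
  · have hnorm : ∑ y, |ε * (c x y - c x' y)| ≤ 2 * ε * Nat.card G := by
      calc ∑ y, |ε * (c x y - c x' y)| ≤ ∑ y, (ε * c x y + ε * c x' y) := by
            refine Finset.sum_le_sum fun y _ => ?_
            have h1 := mul_nonneg hε.le (c_nonneg x y)
            have h2 := mul_nonneg hε.le (c_nonneg x' y)
            rw [mul_sub, abs_le]
            constructor <;> linarith
        _ = _ := by
          rw [Finset.sum_add_distrib, ← Finset.mul_sum, ← Finset.mul_sum, c_tot, c_tot]; ring
    have hdec : ∑ y, |f y - ε * (c x y - c x' y)| - ∑ y, |f y| ≤ ε * (R x - L x') := by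
      have e : ε * (R x - L x') = ∑ y, (ε * c x y * s (f y) - ε * c x' y * s' (f y)) := by
        simp only [R, L]
        rw [← c_sum x fun y => s (f y), ← c_sum x' fun y => s' (f y), ← Finset.sum_sub_distrib,
          Finset.mul_sum]
        exact Finset.sum_congr rfl fun y _ => by ring
      rw [e, ← Finset.sum_sub_distrib]
      refine Finset.sum_le_sum fun y _ => ?_
      have h1 := mul_nonneg hε.le (c_nonneg x y)
      have h2 := mul_nonneg hε.le (c_nonneg x' y)
      have h3 := hεc x y
      have h4 := hεc x' y
      have h5 := hδf y
      simp only [s, s', mul_sub]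
      rcases lt_trichotomy (f y) 0 with hy | hy | hy
      · have := h5 hy.ne
        rw [abs_of_neg hy] at this ⊢
        rw [if_pos hy.le, if_pos hy]
        rcases c_disj y with h0 | h0 <;> rw [h0] at * <;>
        · rw [abs_of_nonpos (by linarith)]; linarith
      · rw [hy, if_pos le_rfl, if_neg (lt_irrefl _)]
        rcases c_disj y with h0 | h0 <;> rw [h0] <;> simp <;>
        · rw [abs_of_nonneg hε.le, abs_of_nonneg (c_nonneg _ _)]
      · have := h5 hy.ne'
        rw [abs_of_pos hy] at this ⊢
        rw [if_neg (not_le.mpr hy), if_neg (not_lt.mpr hy.le)]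
        rcases c_disj y with h0 | h0 <;> rw [h0] at * <;>
        · rw [abs_of_nonneg (by linarith)]; linarith
    have h1 : ε * (2 * Nat.card H) ≤ ∑ y, |f y| - ∑ y, |f y - ε * (c x y - c x' y)| := by
      have := mul_le_mul_of_nonneg_left (show (2 : ℝ) * Nat.card H ≤ L x' - R x by linarith) hε.le
      linarith
    calc (Nat.card H : ℝ) * ∑ y, |ε * (c x y - c x' y)| ≤ Nat.card H * (2 * ε * Nat.card G) :=
          mul_le_mul_of_nonneg_left hnorm hH.le
      _ = Nat.card G * (ε * (2 * Nat.card H)) := by ring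
      _ ≤ _ := mul_le_mul_of_nonneg_left h1 hG.le

end L1

/-! ### Existence of an optimal decomposition. -/

section Optimal
variable {ι B : Type*} [Fintype ι] [PartialOrder ι] [NormedAddCommGroup B] [NormedSpace ℝ B]

/-- A decomposition of `a` of least weighted length, in which no component can be shortened by an
element of an earlier space. -/
theorem exists_optimal (U : ι → Submodule ℝ B) [∀ i, FiniteDimensional ℝ (U i)] (d : ι → ℝ)
    (hd : ∀ i, 0 < d i) (hmono : ∀ i j, i < j → d i < d j) (t₀ : ∀ i, U i)
    (hdesc : ∀ i j, i < j → ∀ x ∈ U j, ∀ β ∈ U i, ‖x - β‖ < ‖x‖ →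
      ∃ β' ∈ U i, β' ∈ U j ∧ β' ≠ 0 ∧ d i * ‖β'‖ ≤ d j * (‖x‖ - ‖x - β'‖)) :
    ∃ t : ∀ i, U i, ∑ i, (t i : B) = ∑ i, (t₀ i : B) ∧
      (∀ t' : ∀ i, U i, ∑ i, (t' i : B) = ∑ i, (t₀ i : B) →
        ∑ i, d i * ‖t i‖ ≤ ∑ i, d i * ‖t' i‖) ∧
      ∀ i j, i < j → ∀ β ∈ U i, ‖(t j : B)‖ ≤ ‖(t j : B) - β‖ := by
  classical
  let a := ∑ i, (t₀ i : B)
  let Θ : (∀ i, U i) → ℝ := fun t => ∑ i, d i * ‖t i‖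
  -- The tie-breaker: squared weights penalise mass that stays in a later space although it could
  -- move to an earlier one at no cost.
  let Θ₂ : (∀ i, U i) → ℝ := fun t => ∑ i, d i * d i * ‖t i‖
  have hΘ : Continuous Θ := by fun_prop
  have hΘ₂ : Continuous Θ₂ := by fun_prop
  let A : Set (∀ i, U i) := {t | ∑ i, (t i : B) = a ∧ Θ t ≤ Θ t₀}
  have hclosed : IsClosed A :=
    (isClosed_eq (by fun_prop) continuous_const).inter (isClosed_le hΘ continuous_const)
  have hA : IsCompact A := by
    refine Metric.isCompact_of_isClosed_isBounded hclosed ?_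
    refine isBounded_iff_forall_norm_le.mpr ⟨∑ i, Θ t₀ / d i, fun t ht => ?_⟩
    have h0 : 0 ≤ Θ t₀ := Finset.sum_nonneg fun i _ => mul_nonneg (hd i).le (norm_nonneg _)
    refine (pi_norm_le_iff_of_nonneg
      (Finset.sum_nonneg fun i _ => div_nonneg h0 (hd i).le)).mpr fun i => ?_
    have h1 : d i * ‖t i‖ ≤ Θ t := Finset.single_le_sum (f := fun i => d i * ‖t i‖)
      (fun i _ => mul_nonneg (hd i).le (norm_nonneg _)) (Finset.mem_univ i)
    calc ‖t i‖ ≤ Θ t₀ / d i := by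
          rw [le_div_iff₀ (hd i), mul_comm]; exact h1.trans ht.2
      _ ≤ _ := Finset.single_le_sum (f := fun i => Θ t₀ / d i)
        (fun i _ => div_nonneg h0 (hd i).le) (Finset.mem_univ i)
  obtain ⟨t₁, ht₁, hmin₁⟩ := hA.exists_isMinOn ⟨t₀, rfl, le_rfl⟩ hΘ.continuousOn
  have hA₂ : IsCompact (A ∩ {t | Θ t ≤ Θ t₁}) :=
    hA.inter_right (isClosed_le hΘ continuous_const)
  obtain ⟨t, ht, hmin₂⟩ := hA₂.exists_isMinOn ⟨t₁, ht₁, le_refl (Θ t₁)⟩ hΘ₂.continuousOn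
  have hbest : ∀ t' : ∀ i, U i, ∑ i, (t' i : B) = a → Θ t ≤ Θ t' := by
    intro t' ht'
    rcases le_total (Θ t') (Θ t₀) with h | h
    · exact (show Θ t ≤ Θ t₁ from ht.2).trans (hmin₁ (show t' ∈ A from ⟨ht', h⟩))
    · exact ht.1.2.trans h
  refine ⟨t, ht.1.1, hbest, fun i j hij β hβ => ?_⟩
  by_contra! hlt
  obtain ⟨β, hi, hj, hne, hle⟩ := hdesc i j hij _ (t j).2 β hβ hlt
  have hpos : 0 < ‖β‖ := norm_pos_iff.mpr hne
  -- Transfer $\beta$ from component $j$ to component $i$; this needs it in both spaces.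
  let t' : ∀ i, U i := Function.update (Function.update t j (t j - ⟨β, hj⟩)) i (t i + ⟨β, hi⟩)
  have e_i : t' i = t i + ⟨β, hi⟩ := Function.update_self ..
  have e_j : t' j = t j - ⟨β, hj⟩ := by
    simp only [t']
    rw [Function.update_of_ne hij.ne', Function.update_self]
  have e_k : ∀ k, k ≠ i ∧ k ≠ j → t' k = t k := fun k hk => by
    simp only [t']
    rw [Function.update_of_ne hk.1, Function.update_of_ne hk.2]
  have hsum : ∑ k, (t' k : B) = a := by
    rw [← show ∑ k, (t k : B) = a from ht.1.1, ← sub_eq_zero, ← Finset.sum_sub_distrib,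
      Fintype.sum_eq_add i j hij.ne fun k hk => by rw [e_k k hk, sub_self], e_i, e_j]
    simp
  have hw : ∀ c : ι → ℝ, ∑ k, c k * ‖t' k‖ - ∑ k, c k * ‖t k‖ =
      c i * (‖(t i : B) + β‖ - ‖(t i : B)‖) + c j * (‖(t j : B) - β‖ - ‖(t j : B)‖) := fun c => by
    rw [← Finset.sum_sub_distrib,
      Fintype.sum_eq_add i j hij.ne fun k hk => by rw [e_k k hk, sub_self], e_i, e_j,
      ← mul_sub, ← mul_sub]
    rfl
  have htri : ‖(t i : B) + β‖ - ‖(t i : B)‖ ≤ ‖β‖ := by linarith [norm_add_le (t i : B) β]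
  have h1 : Θ t' ≤ Θ t := by
    have := hw d
    have := mul_le_mul_of_nonneg_left htri (hd i).le
    simp only [Θ]
    linarith
  have h2 : Θ₂ t' < Θ₂ t := by
    have e := hw fun i => d i * d i
    have b1 := mul_le_mul_of_nonneg_left htri (mul_pos (hd i) (hd i)).le
    have b2 := mul_le_mul_of_nonneg_left hle (hd j).le
    -- $d_i^2\|\beta\|<d_jd_i\|\beta\|\le d_j^2(\|t_j\|-\|t_j-\beta\|)$: the extra factor makes the
    -- comparison strict.
    have b3 := mul_lt_mul_of_pos_right (hmono i j hij) (mul_pos (hd i) hpos)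
    simp only [Θ₂]
    linarith
  have : t' ∈ A ∩ {t | Θ t ≤ Θ t₁} :=
    ⟨⟨hsum, h1.trans ht.1.2⟩, h1.trans ht.2⟩
  exact absurd (hmin₂ this) (not_le.mpr h2)

end Optimal

/-! ### Finite places under automorphisms and extensions. -/

section FinitePlaces
variable {K : Type*} [Field K] [NumberField K]

theorem FinitePlace.lt_one_iff_mem (v : FinitePlace K) (x : 𝓞 K) :
    v (x : K) < 1 ↔ x ∈ v.maximalIdeal.asIdeal := by
  rw [← FinitePlace.norm_embedding_eq]
  exact NumberField.FinitePlace.norm_lt_one_iff_mem K _ x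

theorem FinitePlace.eq_one_iff_notMem (v : FinitePlace K) (x : 𝓞 K) :
    v (x : K) = 1 ↔ x ∉ v.maximalIdeal.asIdeal := by
  rw [← FinitePlace.norm_embedding_eq]
  exact NumberField.FinitePlace.norm_eq_one_iff_notMem K _ x

theorem FinitePlace.le_one (v : FinitePlace K) (x : 𝓞 K) : v (x : K) ≤ 1 := by
  rw [← FinitePlace.norm_embedding_eq]
  exact NumberField.FinitePlace.norm_le_one K _ x

/-- Composing a finite place with an automorphism gives a finite place. -/
theorem isFinitePlace_comp (v : FinitePlace K) (e : K ≃+* K) :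
    IsFinitePlace (v.1.comp (f := e.toRingHom) e.injective) := by
  let e' : 𝓞 K ≃+* 𝓞 K := RingOfIntegers.mapRingEquiv e
  let P := v.maximalIdeal
  let P' : HeightOneSpectrum (𝓞 K) := HeightOneSpectrum.comap e'.toRingHom e'.surjective P
  -- On integers the absolute value is determined by the norm of the prime and the multiplicities,
  -- and the pulled-back prime has the same norm and corresponding multiplicities.
  have hcard : Ideal.absNorm P'.asIdeal = Ideal.absNorm P.asIdeal := by
    rw [Ideal.absNorm_apply, Ideal.absNorm_apply, Submodule.cardQuot_apply,
      Submodule.cardQuot_apply]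
    exact Nat.card_congr (Ideal.quotientEquiv P'.asIdeal P.asIdeal e'
      (Ideal.map_comap_of_surjective e'.toRingHom e'.surjective P.asIdeal).symm).toEquiv
  have hmult : ∀ x : 𝓞 K, multiplicity P'.asIdeal (Ideal.span {x}) =
      multiplicity P.asIdeal (Ideal.span {e' x}) := fun x => by
    have h1 : P'.asIdeal = P.asIdeal.comap (e' : 𝓞 K →+* 𝓞 K) := rfl
    have h2 : P'.asIdeal = P.asIdeal.map (e'.symm : 𝓞 K →+* 𝓞 K) := by
      exact h1.trans (Ideal.map_symm e').symm
    refine multiplicity_eq_of_emultiplicity_eq (emultiplicity_eq_emultiplicity_iff.mpr fun n => ?_)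
    rw [Ideal.dvd_span_singleton, Ideal.dvd_span_singleton, h2, ← Ideal.map_pow,
      show Ideal.map (e'.symm : 𝓞 K →+* 𝓞 K) (P.asIdeal ^ n) = _ from Ideal.map_symm e']
    rfl
  refine ⟨P', ?_⟩
  ext x
  obtain ⟨a, b, hb, rfl⟩ := IsFractionRing.div_surjective (A := 𝓞 K) x
  have key : ∀ a : 𝓞 K, FinitePlace.mk P' (a : K) = v (e a) := fun a => by
    rcases eq_or_ne a 0 with rfl | ha
    · simp
    · have h1 := FinitePlace.apply_mul_absNorm_pow_eq_one (FinitePlace.mk P') ha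
      have h2 := FinitePlace.apply_mul_absNorm_pow_eq_one v
        (show e' a ≠ 0 from (map_ne_zero_iff e' e'.injective).mpr ha)
      rw [FinitePlace.maximalIdeal_mk, hmult, hcard] at h1
      have h3 : ((Ideal.absNorm P.asIdeal : ℝ) ^ multiplicity P.asIdeal (Ideal.span {e' a})) ≠ 0 :=
        fun h => by rw [h, mul_zero] at h1; exact zero_ne_one h1
      exact mul_right_cancel₀ h3 (h1.trans h2.symm)
  have := congrArg₂ (· / ·) (key a) (key b)
  simp only [← map_div₀] at this
  exact this

instance {k : Type*} [Field k] [Algebra k K] : MulAction Gal(K/k) (FinitePlace K) where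
  smul σ v := ⟨_, isFinitePlace_comp v σ.symm.toRingEquiv⟩
  one_smul _ := rfl
  mul_smul _ _ _ := rfl

theorem FinitePlace.smul_apply {k : Type*} [Field k] [Algebra k K] (σ : Gal(K/k))
    (v : FinitePlace K) (x : K) : (σ • v) x = v (σ.symm x) := rfl

variable {L : Type*} [Field L] [NumberField L] [Algebra K L]

/-- The valuation above restricts to a power of the valuation below, with the nonzero ramification
index as exponent. Being equal to $1$ or less than $1$ is insensitive to that exponent and to the
normalisation, and nothing finer is needed. -/
theorem FinitePlace.compare (v : FinitePlace K) (w : FinitePlace L)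
    (h : w.maximalIdeal.asIdeal.LiesOver v.maximalIdeal.asIdeal) (x : K) :
    (w (algebraMap K L x) = 1 ↔ v x = 1) ∧ (w (algebraMap K L x) < 1 ↔ v x < 1) := by
  have h1 := HeightOneSpectrum.valuation_liesOver L v.maximalIdeal w.maximalIdeal x
  have he := Ideal.IsDedekindDomain.ramificationIdx'_ne_zero_of_liesOver w.maximalIdeal.asIdeal
    v.maximalIdeal.ne_bot
  rw [← FinitePlace.norm_embedding_eq, ← FinitePlace.norm_embedding_eq,
    NumberField.FinitePlace.norm_embedding', NumberField.FinitePlace.norm_embedding', ← h1]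
  constructor
  · rw [NNReal.coe_eq_one, NNReal.coe_eq_one,
      WithZeroMulInt.toNNReal_eq_one_iff _ _ (HeightOneSpectrum.one_lt_absNorm_nnreal _).ne',
      WithZeroMulInt.toNNReal_eq_one_iff _ _ (HeightOneSpectrum.one_lt_absNorm_nnreal _).ne',
      ← pow_left_inj₀ (a := HeightOneSpectrum.valuation K v.maximalIdeal x) zero_le zero_le he, one_pow]
  · rw [NNReal.coe_lt_one, NNReal.coe_lt_one,
      WithZeroMulInt.toNNReal_lt_one_iff (HeightOneSpectrum.one_lt_absNorm_nnreal _),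
      WithZeroMulInt.toNNReal_lt_one_iff (HeightOneSpectrum.one_lt_absNorm_nnreal _),
      pow_lt_one_iff he]

variable (L) in
theorem FinitePlace.exists_above (v : FinitePlace K) : ∃ w : FinitePlace L, ∀ x : K,
    (w (algebraMap K L x) = 1 ↔ v x = 1) ∧ (w (algebraMap K L x) < 1 ↔ v x < 1) := by
  obtain ⟨Q, hQ, hlie⟩ := Ideal.exists_maximal_ideal_liesOver_of_isIntegral (S := 𝓞 L) v.maximalIdeal.asIdeal
  have hne : Q ≠ ⊥ := Ideal.ne_bot_of_liesOver_of_ne_bot v.maximalIdeal.ne_bot Q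
  refine ⟨FinitePlace.mk ⟨Q, hQ.isPrime, hne⟩, FinitePlace.compare v _ ?_⟩
  rw [FinitePlace.maximalIdeal_mk]
  exact hlie

variable (K) in
theorem FinitePlace.exists_below (w : FinitePlace L) : ∃ v : FinitePlace K, ∀ x : K,
    (w (algebraMap K L x) = 1 ↔ v x = 1) ∧ (w (algebraMap K L x) < 1 ↔ v x < 1) := by
  refine ⟨FinitePlace.mk (w.maximalIdeal.under (𝓞 K)), FinitePlace.compare _ w ?_⟩
  rw [FinitePlace.maximalIdeal_mk]
  exact ⟨rfl⟩

/-- The norm of the prime ideal lies in the ideal; were all rational primes of value $1$, this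
positive integer would have value $1$ too. -/
theorem FinitePlace.exists_prime_lt_one (v : FinitePlace K) : ∃ p : Nat.Primes, v (p : ℕ) < 1 := by
  have hN : v ((Ideal.absNorm v.maximalIdeal.asIdeal : ℕ) : K) < 1 := by
    have := (FinitePlace.lt_one_iff_mem v (Ideal.absNorm v.maximalIdeal.asIdeal : ℕ)).mpr
      (Ideal.absNorm_mem _)
    simpa using this
  by_contra! h
  have h1 : ∀ p : ℕ, p.Prime → v (p : K) = 1 := fun p hp => by
    refine le_antisymm ?_ (h ⟨p, hp⟩)
    simpa using FinitePlace.le_one v (p : 𝓞 K)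
  have h2 : ∀ n : ℕ, n ≠ 0 → v (n : K) = 1 := fun n => by
    induction n using Nat.recOnMul with
    | zero => simp
    | one => simp
    | prime p hp => exact fun _ => h1 p hp
    | mul a b ha hb =>
      intro hab
      rw [Nat.cast_mul, map_mul, ha (left_ne_zero_of_mul hab), hb (right_ne_zero_of_mul hab),
        one_mul]
  rw [h2 _ (Ideal.absNorm_eq_zero_iff.not.mpr v.maximalIdeal.ne_bot)] at hN
  exact lt_irrefl _ hN

/-- By Bézout, two distinct primes in the maximal ideal would put $1$ in it. -/
theorem FinitePlace.prime_unique (v : FinitePlace K) {p q : Nat.Primes} (hp : v (p : ℕ) < 1)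
    (hq : v (q : ℕ) < 1) : p = q := by
  by_contra hne
  have hc : IsCoprime ((p : ℕ) : ℤ) ((q : ℕ) : ℤ) :=
    Nat.isCoprime_iff_coprime.mpr ((Nat.coprime_primes p.2 q.2).mpr fun h => hne (Subtype.ext h))
  obtain ⟨a, b, hab⟩ := hc
  have hp' := (FinitePlace.lt_one_iff_mem v ((p : ℕ) : 𝓞 K)).mp (by simpa using hp)
  have hq' := (FinitePlace.lt_one_iff_mem v ((q : ℕ) : 𝓞 K)).mp (by simpa using hq)
  refine v.maximalIdeal.isPrime.ne_top ((Ideal.eq_top_iff_one _).mpr ?_)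
  have : (1 : 𝓞 K) = a * ((p : ℕ) : 𝓞 K) + b * ((q : ℕ) : 𝓞 K) := by exact_mod_cast hab.symm
  rw [this]
  exact add_mem (Ideal.mul_mem_left _ _ hp') (Ideal.mul_mem_left _ _ hq')

end FinitePlaces

/-! ### Finite generation of $T$-units up to powers. -/

section SUnits
variable {K : Type*} [Field K] [NumberField K]

/-- The `T`-units: elements of value `1` at the finite places outside `T`. -/
def sUnits (T : Set (FinitePlace K)) : Subgroup Kˣ where
  carrier := {x | ∀ v ∉ T, v (x : K) = 1}
  one_mem' v _ := by simp
  mul_mem' hx hy v hv := by simp [hx v hv, hy v hv]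
  inv_mem' hx v hv := by simp [hx v hv]

theorem FinitePlace.exists_zpow (v : FinitePlace K) (x : Kˣ) :
    ∃ m : ℤ, v (x : K) = (Ideal.absNorm v.maximalIdeal.asIdeal : ℝ) ^ m := by
  obtain ⟨a, b, hb, hx⟩ := IsFractionRing.div_surjective (A := 𝓞 K) (x : K)
  have hb0 : b ≠ 0 := nonZeroDivisors.ne_zero hb
  have ha0 : a ≠ 0 := by rintro rfl; simp [eq_comm] at hx
  have h1 := FinitePlace.apply_mul_absNorm_pow_eq_one v ha0
  have h2 := FinitePlace.apply_mul_absNorm_pow_eq_one v hb0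
  have hN : (Ideal.absNorm v.maximalIdeal.asIdeal : ℝ) ≠ 0 := by
    exact_mod_cast Ideal.absNorm_eq_zero_iff.not.mpr v.maximalIdeal.ne_bot
  refine ⟨multiplicity v.maximalIdeal.asIdeal (Ideal.span {b}) -
    multiplicity v.maximalIdeal.asIdeal (Ideal.span {a}), ?_⟩
  rw [← hx, map_div₀, zpow_sub₀ hN, zpow_natCast, zpow_natCast]
  have e1 := eq_one_div_of_mul_eq_one_left h1
  have e2 := eq_one_div_of_mul_eq_one_left h2
  rw [show v ((algebraMap (𝓞 K) K) a) = _ from e1, show v ((algebraMap (𝓞 K) K) b) = _ from e2]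
  field_simp

variable (K) in
/-- Finiteness of the class group gives, for each finite place, an element supported there. -/
theorem exists_uniformizing_power : ∃ h : ℕ, h ≠ 0 ∧ ∀ v : FinitePlace K, ∃ x : Kˣ,
    x ∈ sUnits {v} ∧ v (x : K) < 1 ∧ ∀ y : Kˣ, ∃ m : ℤ, v (y : K) ^ h = v (x : K) ^ m := by
  refine ⟨Fintype.card (ClassGroup (𝓞 K)), Fintype.card_ne_zero, fun v => ?_⟩
  set h := Fintype.card (ClassGroup (𝓞 K))
  have hh : h ≠ 0 := Fintype.card_ne_zero
  let P := v.maximalIdeal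
  have hP0 : P.asIdeal ^ h ∈ nonZeroDivisors (Ideal (𝓞 K)) :=
    pow_mem (mem_nonZeroDivisors_of_ne_zero P.ne_bot) h
  -- Here $h$ is the class number; a generator of $P^h$ is the element sought.
  have hprin : (P.asIdeal ^ h).IsPrincipal := by
    rw [← ClassGroup.mk0_eq_one_iff hP0]
    have : (⟨P.asIdeal ^ h, hP0⟩ : nonZeroDivisors (Ideal (𝓞 K))) =
        ⟨P.asIdeal, mem_nonZeroDivisors_of_ne_zero P.ne_bot⟩ ^ h := rfl
    rw [this, map_pow, pow_card_eq_one]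
  obtain ⟨a, ha⟩ := hprin
  rw [Ideal.submodule_span_eq] at ha
  have ha0 : a ≠ 0 := by
    rintro rfl
    rw [Ideal.span_singleton_eq_bot.mpr rfl] at ha
    exact P.ne_bot (eq_zero_of_pow_eq_zero ha)
  have haK : (a : K) ≠ 0 := by simpa using ha0
  have hval := FinitePlace.apply_mul_absNorm_pow_eq_one v ha0
  rw [← ha, multiplicity_pow_self_of_prime P.prime] at hval
  refine ⟨Units.mk0 a haK, fun w hw => ?_, ?_, fun y => ?_⟩
  · refine (FinitePlace.eq_one_iff_notMem w a).mpr fun hmem => hw ?_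
    have h1 : P.asIdeal ^ h ≤ w.maximalIdeal.asIdeal := by
      rw [ha, Ideal.span_singleton_le_iff_mem]; exact hmem
    have h2 := w.maximalIdeal.isPrime.le_of_pow_le h1
    have h3 : P = w.maximalIdeal :=
      HeightOneSpectrum.ext (P.isMaximal.eq_of_le w.maximalIdeal.isPrime.ne_top h2)
    exact (FinitePlace.maximalIdeal_injective h3).symm
  · refine (FinitePlace.lt_one_iff_mem v a).mpr ?_
    exact Ideal.pow_le_self hh (ha ▸ Ideal.mem_span_singleton_self a)
  · obtain ⟨m, hm⟩ := FinitePlace.exists_zpow v y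
    refine ⟨-m, ?_⟩
    rw [Units.val_mk0, eq_one_div_of_mul_eq_one_left hval, hm, one_div, inv_zpow', neg_neg,
      ← zpow_natCast, ← zpow_natCast, zpow_comm]

theorem exists_unit_of_forall_eq_one (x : Kˣ) (hx : ∀ v : FinitePlace K, v (x : K) = 1) :
    ∃ u : (𝓞 K)ˣ, ((u : 𝓞 K) : K) = x := by
  have key : ∀ y : Kˣ, (∀ v : FinitePlace K, v (y : K) = 1) → ∃ a : 𝓞 K, (a : K) = y := by
    intro y hy
    refine HeightOneSpectrum.mem_integers_of_valuation_le_one (R := 𝓞 K) K (y : K) fun P => ?_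
    have h := hy (FinitePlace.mk P)
    rw [FinitePlace.mk_apply, NumberField.FinitePlace.norm_embedding', NNReal.coe_eq_one,
      WithZeroMulInt.toNNReal_eq_one_iff _ _ (HeightOneSpectrum.one_lt_absNorm_nnreal _).ne'] at h
    exact h.le
  obtain ⟨a, ha⟩ := key x hx
  obtain ⟨b, hb⟩ := key x⁻¹ fun v => by simp [hx v]
  have hab : a * b = 1 := by
    apply RingOfIntegers.coe_injective
    rw [map_mul, show algebraMap (𝓞 K) K a = _ from ha, show algebraMap (𝓞 K) K b = _ from hb]
    simp
  exact ⟨Units.mkOfMulEqOne a b hab, ha⟩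

/-- Up to powers, the `T`-units are finitely generated. -/
theorem sUnits_almost_fg (T : Finset (FinitePlace K)) : ∃ g : Finset Kˣ,
    (∀ x ∈ g, x ∈ sUnits (T : Set (FinitePlace K))) ∧ ∃ h : ℕ, h ≠ 0 ∧
      ∀ y ∈ sUnits (T : Set (FinitePlace K)), y ^ h ∈ Subgroup.closure (g : Set Kˣ) := by
  classical
  obtain ⟨h, hh, hex⟩ := exists_uniformizing_power K
  choose x hxS hxlt hxm using hex
  obtain ⟨s, hs⟩ := (Group.fg_def (G := (𝓞 K)ˣ)).mp (Group.fg_iff_monoid_fg.mpr inferInstance)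
  let ι : (𝓞 K)ˣ →* Kˣ := Units.map (algebraMap (𝓞 K) K).toMonoidHom
  have hι : ∀ (u : (𝓞 K)ˣ) (v : FinitePlace K), v (ι u : K) = 1 := fun u v =>
    (FinitePlace.eq_one_iff_notMem v (u : 𝓞 K)).mpr fun hmem =>
      v.maximalIdeal.isPrime.ne_top (Ideal.eq_top_of_isUnit_mem _ hmem u.isUnit)
  refine ⟨s.image ι ∪ T.image x, fun y hy => ?_, h, hh, fun y hy => ?_⟩
  · rcases Finset.mem_union.mp hy with hy | hy
    · obtain ⟨u, -, rfl⟩ := Finset.mem_image.mp hy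
      exact fun v _ => hι u v
    · obtain ⟨w, hw, rfl⟩ := Finset.mem_image.mp hy
      exact fun v hv => hxS w v fun h => hv (by rw [Set.mem_singleton_iff.mp h]; exact hw)
  · choose m hm using fun v => hxm v y
    -- Dividing $y^h$ by suitable powers of the elements attached to $T$ leaves an element of value
    -- $1$ at every finite place, that is, a unit of $\mathcal O_K$.
    have hz : ∀ v : FinitePlace K, v ((y ^ h * (∏ w ∈ T, x w ^ m w)⁻¹ : Kˣ) : K) = 1 := by
      intro v
      have hprod : v ((∏ w ∈ T, x w ^ m w : Kˣ) : K) = v (y : K) ^ h := by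
        rw [Units.coe_prod, map_prod]
        by_cases hv : v ∈ T
        · rw [Finset.prod_eq_single_of_mem v hv fun w _ hw => ?_, hm v, Units.val_zpow_eq_zpow_val,
            map_zpow₀]
          rw [Units.val_zpow_eq_zpow_val, map_zpow₀, hxS w v fun h => hw h.symm, one_zpow]
        · rw [hy v (by simpa using hv), one_pow]
          refine Finset.prod_eq_one fun w hw => ?_
          rw [Units.val_zpow_eq_zpow_val, map_zpow₀,
            hxS w v fun h => hv (by rw [Set.mem_singleton_iff.mp h]; exact hw), one_zpow]
      have h0 : v (y : K) ≠ 0 := by simp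
      rw [Units.val_mul, map_mul, Units.val_inv_eq_inv_val, map_inv₀, hprod, Units.val_pow_eq_pow_val,
        map_pow, mul_inv_cancel₀ (pow_ne_zero h h0)]
    obtain ⟨u, hu⟩ := exists_unit_of_forall_eq_one _ hz
    have e : y ^ h = ι u * ∏ w ∈ T, x w ^ m w := by
      rw [show ι u = _ from Units.ext hu, inv_mul_cancel_right]
    rw [e]
    refine mul_mem ?_ (Subgroup.prod_mem _ fun w hw => Subgroup.zpow_mem _
      (Subgroup.subset_closure (by simpa using Or.inr ⟨w, hw, rfl⟩)) _)
    have hu' : ι u ∈ (Subgroup.closure (s : Set (𝓞 K)ˣ)).map ι :=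
      Subgroup.mem_map_of_mem ι (hs ▸ Subgroup.mem_top u)
    rw [MonoidHom.map_closure] at hu'
    exact Subgroup.closure_mono (by simp) hu'

end SUnits

/-! ### Local logarithms and the real span of the $T$-unit vectors. -/

section Places
variable (K : Type*) [Field K] [NumberField K]

/-- The places of a number field. -/
abbrev Place : Type _ := InfinitePlace K ⊕ FinitePlace K

variable {K}

/-- `[K_w : ℚ_w] * log ‖x‖_w`. -/
def logAt : Place K → Additive Kˣ →+ ℝ
  | Sum.inl v =>
    { toFun := fun x => v.mult * Real.log (v (x.toMul : K))
      map_zero' := by simp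
      map_add' := fun x y => by
        rw [toMul_add, Units.val_mul, map_mul, Real.log_mul (by simp) (by simp), mul_add] }
  | Sum.inr v =>
    { toFun := fun x => Real.log (v (x.toMul : K))
      map_zero' := by simp
      map_add' := fun x y => by
        rw [toMul_add, Units.val_mul, map_mul, Real.log_mul (by simp) (by simp)] }

theorem logAt_inl (v : InfinitePlace K) (x : Additive Kˣ) :
    logAt (Sum.inl v) x = v.mult * Real.log (v (x.toMul : K)) := rfl

theorem logAt_inr (v : FinitePlace K) (x : Additive Kˣ) :
    logAt (Sum.inr v) x = Real.log (v (x.toMul : K)) := rfl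

theorem logAt_inr_eq_zero {v : FinitePlace K} {x : Additive Kˣ} :
    logAt (Sum.inr v) x = 0 ↔ v (x.toMul : K) = 1 := by
  have hpos : 0 < v (x.toMul : K) := FinitePlace.pos_iff.mpr x.toMul.ne_zero
  rw [logAt_inr]
  exact ⟨fun h => Real.eq_one_of_pos_of_log_eq_zero hpos h, fun h => by rw [h, Real.log_one]⟩

theorem logAt_smul {k : Type*} [Field k] [Algebra k K] (σ : Gal(K/k)) (w : Place K)
    (x : Additive Kˣ) :
    logAt (σ • w) x = logAt w (Additive.ofMul (Units.map (σ.symm : K →* K) x.toMul)) := by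
  rcases w with w | w
  · have : (σ • w).mult = w.mult := by
      have h := InfinitePlace.isReal_smul_iff (σ := σ) (w := w)
      unfold InfinitePlace.mult
      split_ifs <;> tauto
    rw [Sum.smul_inl, logAt_inl, logAt_inl, this]
    rfl
  · rfl

/-- The infinite places together with the finite places in `T`. -/
def placesWith (T : Finset (FinitePlace K)) : Finset (Place K) := Finset.univ.disjSum T

theorem inl_mem_placesWith (T : Finset (FinitePlace K)) (v : InfinitePlace K) :
    Sum.inl v ∈ placesWith T := by simp [placesWith]

theorem inr_mem_placesWith {T : Finset (FinitePlace K)} {v : FinitePlace K} :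
    Sum.inr v ∈ placesWith T ↔ v ∈ T := by simp [placesWith]

theorem sum_abs_logAt (T : Finset (FinitePlace K)) (x : Additive Kˣ)
    (hx : ∀ v ∉ T, logAt (Sum.inr v) x = 0) :
    ∑ w ∈ placesWith T, |logAt w x| = localSum K (x.toMul : K) := by
  rw [placesWith, Finset.sum_disjSum, localSum]
  congr 1
  · refine Finset.sum_congr rfl fun v _ => ?_
    rw [logAt_inl, abs_mul, Nat.abs_cast]
  · rw [finsum_eq_sum_of_support_subset (s := T)]
    · rfl
    · intro v hv
      by_contra h
      have := hx v h
      rw [logAt_inr] at this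
      simp [this] at hv

/-- The product formula, restricted to a set of places that contains the support. -/
theorem sum_logAt (T : Finset (FinitePlace K)) (x : Additive Kˣ)
    (hx : ∀ v ∉ T, logAt (Sum.inr v) x = 0) : ∑ w ∈ placesWith T, logAt w x = 0 := by
  have h := congrArg Real.log (prod_abs_eq_one x.toMul.ne_zero)
  have hpos : ∀ v : FinitePlace K, 0 < v (x.toMul : K) := fun v =>
    FinitePlace.pos_iff.mpr x.toMul.ne_zero
  have hpos' : ∀ v : InfinitePlace K, 0 < v (x.toMul : K) := fun v =>
    InfinitePlace.pos_iff.mpr x.toMul.ne_zero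
  rw [finprod_eq_prod_of_mulSupport_subset (s := T), Real.log_mul, Real.log_prod, Real.log_prod,
    Real.log_one] at h
  · rw [placesWith, Finset.sum_disjSum, ← h]
    congr 1
    refine Finset.sum_congr rfl fun v _ => ?_
    rw [logAt_inl, Real.log_pow]
  · exact fun v _ => (hpos v).ne'
  · exact fun v _ => pow_ne_zero _ (hpos' v).ne'
  · exact Finset.prod_ne_zero_iff.mpr fun v _ => pow_ne_zero _ (hpos' v).ne'
  · exact Finset.prod_ne_zero_iff.mpr fun v _ => (hpos v).ne'
  · intro v hv
    by_contra h
    exact hv (logAt_inr_eq_zero.mp (hx v h))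

theorem exists_support (x : Additive Kˣ) : ∃ T : Finset (FinitePlace K),
    ∀ v ∉ T, logAt (Sum.inr v) x = 0 := by
  refine ⟨(FinitePlace.hasFiniteMulSupport x.toMul.ne_zero).toFinset, fun v hv => ?_⟩
  rw [logAt_inr_eq_zero]
  by_contra h
  exact hv ((Set.Finite.mem_toFinset _).mpr h)

open Units.dirichletUnitTheorem in
/-- The logarithmic vectors of the `T`-units span all zero-sum vectors supported on `T`. -/
theorem mem_span_logAt (T : Finset (FinitePlace K)) (f : Place K → ℝ)
    (hf : ∀ v ∉ T, f (Sum.inr v) = 0) (hsum : ∑ w ∈ placesWith T, f w = 0) :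
    f ∈ Submodule.span ℝ {u : Place K → ℝ | ∃ y ∈ sUnits (T : Set (FinitePlace K)),
      u = fun w => logAt w (Additive.ofMul y)} := by
  classical
  set W := Submodule.span ℝ {u : Place K → ℝ | ∃ y ∈ sUnits (T : Set (FinitePlace K)),
      u = fun w => logAt w (Additive.ofMul y)} with hW
  -- Vectors supported at infinity: Dirichlet's theorem says that the unit lattice spans `logSpace
  -- K`.
  have arch : ∀ f : Place K → ℝ, (∀ v, f (Sum.inr v) = 0) → ∑ v, f (Sum.inl v) = 0 → f ∈ W := by
    intro f hf hsum
    -- `logSpace K` omits the coordinate at `w₀`; it is restored by the zero-sum condition.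
    let Ψ : logSpace K →ₗ[ℝ] (Place K → ℝ) :=
      { toFun := fun u => Sum.elim (fun v => if h : v = w₀ then - ∑ w, u w else u ⟨v, h⟩) fun _ => 0
        map_add' := fun u u' => by
          ext (v | v)
          · by_cases h : v = w₀ <;> simp [h, Finset.sum_add_distrib, add_comm]
          · simp
        map_smul' := fun c u => by
          ext (v | v)
          · by_cases h : v = w₀ <;> simp [h, Finset.mul_sum]
          · simp }
    have hΨ : ∀ u : logSpace K, Ψ u ∈ W := by
      intro u
      have hu : u ∈ Submodule.span ℝ (Units.unitLattice K : Set (logSpace K)) := by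
        rw [unitLattice_span_eq_top]; trivial
      have hle : Submodule.span ℝ (Units.unitLattice K : Set (logSpace K)) ≤ W.comap Ψ := by
        rw [Submodule.span_le]
        rintro _ ⟨e, -, rfl⟩
        let y : Kˣ := Units.map (algebraMap (𝓞 K) K).toMonoidHom e.toMul
        have hy : ∀ v : FinitePlace K, v (y : K) = 1 := fun v =>
          (FinitePlace.eq_one_iff_notMem v (e.toMul : 𝓞 K)).mpr fun hmem =>
            v.maximalIdeal.isPrime.ne_top (Ideal.eq_top_of_isUnit_mem _ hmem e.toMul.isUnit)
        refine Submodule.subset_span ⟨y, fun v _ => hy v, ?_⟩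
        ext (v | v)
        · by_cases h : v = w₀
          · subst h
            simp only [Ψ, LinearMap.coe_mk, AddHom.coe_mk, Sum.elim_inl, dif_pos]
            refine (congrArg Neg.neg (sum_logEmbedding_component e.toMul)).trans ?_
            rw [neg_mul, neg_neg]
            rfl
          · simp only [Ψ, LinearMap.coe_mk, AddHom.coe_mk, Sum.elim_inl, dif_neg h]
            rfl
        · exact (logAt_inr_eq_zero.mpr (hy v)).symm
      exact hle hu
    convert hΨ fun w => f (Sum.inl w.1) using 1
    ext (v | v)
    · by_cases h : v = w₀
      · subst h
        rw [Fintype.sum_eq_add_sum_subtype_ne _ w₀] at hsum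
        simp only [Ψ, LinearMap.coe_mk, AddHom.coe_mk, Sum.elim_inl, dif_pos]
        linarith
      · simp [Ψ, h]
    · exact hf v
  obtain ⟨h, hh, hex⟩ := exists_uniformizing_power K
  choose x hxS hxlt hxm using hex
  let ξ : FinitePlace K → Place K → ℝ := fun v w => logAt w (Additive.ofMul (x v))
  have hξT : ∀ v ∈ T, ∀ v' ∉ T, logAt (Sum.inr v') (Additive.ofMul (x v)) = 0 :=
    fun v hv v' hv' => logAt_inr_eq_zero.mpr (hxS v v' fun h => hv' (by
      rw [Set.mem_singleton_iff.mp h]; exact hv))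
  have hξW : ∀ v ∈ T, ξ v ∈ W := fun v hv =>
    Submodule.subset_span ⟨x v, fun v' hv' => logAt_inr_eq_zero.mp (hξT v hv v' (by simpa using hv')),
      rfl⟩
  have hξ0 : ∀ v v', v' ≠ v → ξ v (Sum.inr v') = 0 := fun v v' hne =>
    logAt_inr_eq_zero.mpr (hxS v v' hne)
  have hξ1 : ∀ v, ξ v (Sum.inr v) ≠ 0 := fun v hv => (hxlt v).ne (logAt_inr_eq_zero.mp hv)
  -- The matrix of the vectors $\xi_v$ at the finite places is diagonal, so $g$ matches $f$ at all
  -- finite places and $f-g$ is purely archimedean.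
  let g : Place K → ℝ := ∑ v ∈ T, (f (Sum.inr v) / ξ v (Sum.inr v)) • ξ v
  have hgW : g ∈ W := Submodule.sum_mem _ fun v hv => Submodule.smul_mem _ _ (hξW v hv)
  have hg : ∀ v, g (Sum.inr v) = f (Sum.inr v) := by
    intro v
    simp only [g, Finset.sum_apply, Pi.smul_apply, smul_eq_mul]
    by_cases hv : v ∈ T
    · rw [Finset.sum_eq_single_of_mem v hv fun v' _ hne => by rw [hξ0 v' v hne.symm, mul_zero],
        div_mul_cancel₀ _ (hξ1 v)]
    · rw [hf v hv]
      exact Finset.sum_eq_zero fun v' hv' => by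
        rw [hξ0 v' v fun h => hv (h ▸ hv'), mul_zero]
  have hgsum : ∑ w ∈ placesWith T, g w = 0 := by
    simp only [g, Finset.sum_apply, Pi.smul_apply, smul_eq_mul]
    rw [Finset.sum_comm]
    refine Finset.sum_eq_zero fun v hv => ?_
    rw [← Finset.mul_sum, sum_logAt T _ (hξT v hv), mul_zero]
  rw [← sub_add_cancel f g]
  refine add_mem (arch _ (fun v => by simp [hg]) ?_) hgW
  have h1 : ∑ w ∈ placesWith T, (f - g) w = 0 := by
    simp only [Pi.sub_apply, Finset.sum_sub_distrib, hsum, hgsum, sub_zero]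
  rw [placesWith, Finset.sum_disjSum] at h1
  rwa [Finset.sum_eq_zero (s := T) fun v _ => by simp [hg], add_zero] at h1

end Places

/-! ### Extending homomorphisms from subgroups of rational vector spaces. -/

section Extension
variable {A M V : Type*} [AddCommGroup A] [AddCommGroup M] [Module ℚ M] [AddCommGroup V] [Module ℚ V]

/-- Elements of the rational span of a subgroup have a multiple in it. -/
theorem exists_nsmul_eq_of_mem_span (i : A →+ M) {b : M}
    (hb : b ∈ Submodule.span ℚ (Set.range i)) : ∃ n : ℕ, n ≠ 0 ∧ ∃ a, n • b = i a := by
  induction hb using Submodule.span_induction with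
  | mem x hx => obtain ⟨a, rfl⟩ := hx; exact ⟨1, one_ne_zero, a, one_smul _ _⟩
  | zero => exact ⟨1, one_ne_zero, 0, by simp⟩
  | add x y _ _ hx hy =>
    obtain ⟨n, hn, a, ha⟩ := hx
    obtain ⟨m, hm, c, hc⟩ := hy
    refine ⟨n * m, mul_ne_zero hn hm, m • a + n • c, ?_⟩
    rw [map_add, map_nsmul, map_nsmul, ← ha, ← hc, smul_add, smul_smul, smul_smul, mul_comm m n]
  | smul q x _ hx =>
    obtain ⟨n, hn, a, ha⟩ := hx
    refine ⟨n * q.den, mul_ne_zero hn q.den_nz, q.num • a, ?_⟩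
    rw [map_zsmul, ← ha, ← Nat.cast_smul_eq_nsmul ℚ, ← Nat.cast_smul_eq_nsmul ℚ,
      ← Int.cast_smul_eq_zsmul ℚ, smul_smul, smul_smul]
    congr 1
    rw [← Rat.mul_den_eq_num q]
    push_cast
    ring

/-- A homomorphism on a subgroup of a rational vector space extends to a linear map. -/
theorem exists_linearMap_extension (i : A →+ M) (φ : A →+ V) (h : ∀ a, i a = 0 → φ a = 0) :
    ∃ Λ : M →ₗ[ℚ] V, ∀ a, Λ (i a) = φ a := by
  let N := Submodule.span ℚ (Set.range i)
  choose n hn a ha using fun b : N => exists_nsmul_eq_of_mem_span i b.2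
  have hq : ∀ b, (n b : ℚ) ≠ 0 := fun b => by exact_mod_cast hn b
  -- The value $\varphi(a)/n$ does not depend on the choice of $n$ and $a$ with $n\cdot b=i(a)$.
  have key : ∀ (b : N) (m : ℕ) (c : A), m ≠ 0 → m • (b : M) = i c →
      (n b : ℚ)⁻¹ • φ (a b) = (m : ℚ)⁻¹ • φ c := by
    intro b m c hm hc
    have hm' : (m : ℚ) ≠ 0 := by exact_mod_cast hm
    have h0 : φ (m • a b - n b • c) = 0 := h _ (by
      rw [map_sub, map_nsmul, map_nsmul, ← ha, ← hc, smul_smul, smul_smul, mul_comm, sub_self])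
    rw [map_sub, map_nsmul, map_nsmul, sub_eq_zero, ← Nat.cast_smul_eq_nsmul ℚ,
      ← Nat.cast_smul_eq_nsmul ℚ] at h0
    rw [inv_smul_eq_iff₀ (hq b), smul_comm, eq_inv_smul_iff₀ hm']
    exact h0
  let φN : N →+ V := AddMonoidHom.mk' (fun b => (n b : ℚ)⁻¹ • φ (a b)) fun b c => by
    rw [key (b + c) (n b * n c) (n c • a b + n b • a c) (mul_ne_zero (hn b) (hn c)) (by
      rw [map_add, map_nsmul, map_nsmul, ← ha, ← ha, smul_smul, smul_smul, mul_comm (n c),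
        ← smul_add]; rfl), map_add, map_nsmul, map_nsmul, smul_add,
      ← Nat.cast_smul_eq_nsmul ℚ, ← Nat.cast_smul_eq_nsmul ℚ, smul_smul, smul_smul]
    have h1 := hq b
    have h2 := hq c
    congr 2 <;> push_cast <;> field_simp
  -- Off the rational span of the range the extension is an arbitrary choice.
  obtain ⟨Λ, hΛ⟩ := LinearMap.exists_extend φN.toRatLinearMap
  refine ⟨Λ, fun x => ?_⟩
  have h1 := LinearMap.congr_fun hΛ ⟨i x, Submodule.subset_span ⟨x, rfl⟩⟩
  refine h1.trans ?_
  refine (key _ 1 x one_ne_zero (one_smul _ _)).trans ?_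
  simp

end Extension

/-! ### Local logarithms and the height on $V_K$. -/

section Classes
variable (K : IntermediateField ℚ Qbar)

/-- The class of a nonzero element of a subfield. -/
def unitCls : Additive Kˣ →+ AlgModTorsion where
  toFun x := cls (Units.map (K.val : K →* Qbar) x.toMul)
  map_zero' := by simp [cls_one]
  map_add' x y := by rw [toMul_add, map_mul, cls_mul]

theorem unitCls_apply (x : Additive Kˣ) :
    unitCls K x = cls (Units.map (K.val : K →* Qbar) x.toMul) := rfl

variable {K} in
theorem cls_eq_unitCls {x : Qbarˣ} (hx : (x : Qbar) ∈ K) : ∃ y : Kˣ, (y : K) = ⟨x, hx⟩ ∧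
    cls x = unitCls K (Additive.ofMul y) := by
  have h0 : (⟨x, hx⟩ : K) ≠ 0 := fun h => x.ne_zero (congrArg Subtype.val h)
  exact ⟨Units.mk0 _ h0, rfl, congrArg cls (Units.ext rfl)⟩

theorem fieldSpace_eq_span : fieldSpace K = Submodule.span ℚ (Set.range (unitCls K)) := by
  rw [fieldSpace]
  congr 1
  ext a
  constructor
  · rintro ⟨x, hx, rfl⟩
    obtain ⟨y, -, h⟩ := cls_eq_unitCls hx
    exact ⟨_, h.symm⟩
  · rintro ⟨y, rfl⟩
    exact ⟨_, (y.toMul : K).2, rfl⟩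

theorem unitCls_mem (x : Additive Kˣ) : unitCls K x ∈ fieldSpace K := by
  rw [fieldSpace_eq_span]; exact Submodule.subset_span ⟨x, rfl⟩

variable {K}

theorem cls_mem_fieldSpace {x : Qbarˣ} (hx : (x : Qbar) ∈ K) : cls x ∈ fieldSpace K :=
  Submodule.subset_span ⟨x, hx, rfl⟩

theorem exists_nsmul_eq_unitCls {b : AlgModTorsion} (hb : b ∈ fieldSpace K) :
    ∃ n : ℕ, n ≠ 0 ∧ ∃ x, n • b = unitCls K x :=
  exists_nsmul_eq_of_mem_span (unitCls K) (by rwa [← fieldSpace_eq_span])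

theorem fieldSpace_mono {E F : IntermediateField ℚ Qbar} (h : E ≤ F) :
    fieldSpace E ≤ fieldSpace F :=
  Submodule.span_mono fun _ ⟨x, hx, e⟩ => ⟨x, h hx, e⟩

variable [FiniteDimensional ℚ K]

theorem logAt_eq_zero_of_unitCls (w : Place K) (x : Additive Kˣ) (hx : unitCls K x = 0) :
    logAt w x = 0 := by
  have h : (1 : Qbarˣ)⁻¹ * Units.map (K.val : K →* Qbar) x.toMul ∈ CommGroup.torsion Qbarˣ :=
    cls_eq_iff.mp (by rw [cls_one, ← unitCls_apply, hx])
  rw [inv_one, one_mul] at h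
  obtain ⟨n, hn, h⟩ := isOfFinOrder_iff_pow_eq_one.mp h
  have h1 : x.toMul ^ n = 1 := by
    rw [← map_pow] at h
    exact Units.map_injective (f := (K.val : K →* Qbar)) K.val.injective (by rw [h, map_one])
  have h2 : n • x = 0 := h1
  have h3 : (n : ℝ) * logAt w x = 0 := by
    rw [← nsmul_eq_mul, ← map_nsmul, h2, map_zero]
  exact (mul_eq_zero.mp h3).resolve_left (by positivity)

/-- `[K_w : ℚ_w] * log ‖a‖_w`, for classes `a` in `V_K`, extended linearly to all classes. -/
def placeLog (w : Place K) : AlgModTorsion →ₗ[ℚ] ℝ :=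
  (exists_linearMap_extension (unitCls K) (logAt w) (logAt_eq_zero_of_unitCls w)).choose

theorem placeLog_unitCls (w : Place K) (x : Additive Kˣ) : placeLog w (unitCls K x) = logAt w x :=
  (exists_linearMap_extension (unitCls K) (logAt w) (logAt_eq_zero_of_unitCls w)).choose_spec x

theorem placeLog_of_nsmul (w : Place K) {b : AlgModTorsion} {n : ℕ} {x : Additive Kˣ}
    (h : n • b = unitCls K x) : (n : ℝ) * placeLog w b = logAt w x := by
  rw [← placeLog_unitCls, ← h, map_nsmul, nsmul_eq_mul]

theorem finrank_mul_norm_unitCls (x : Additive Kˣ) :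
    (Module.finrank ℚ K : ℝ) * ‖unitCls K x‖ = localSum K (x.toMul : K) := by
  have hK : (0 : ℝ) < Module.finrank ℚ K := mod_cast Module.finrank_pos
  rw [norm_eq, unitCls_apply, h₁_cls]
  have := weilHeight_eq K x.toMul.ne_zero
  rw [show ((Units.map (K.val : K →* Qbar) x.toMul : Qbarˣ) : Qbar) = ((x.toMul : K) : Qbar) from rfl,
    this, heightIn, mul_div_cancel₀ _ hK.ne']

theorem exists_support_placeLog {b : AlgModTorsion} (hb : b ∈ fieldSpace K) :
    ∃ T : Finset (FinitePlace K), ∀ v ∉ T, placeLog (Sum.inr v) b = 0 := by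
  obtain ⟨n, hn, x, hx⟩ := exists_nsmul_eq_unitCls hb
  obtain ⟨T, hT⟩ := exists_support x
  refine ⟨T, fun v hv => ?_⟩
  have := placeLog_of_nsmul (Sum.inr v) hx
  rw [hT v hv] at this
  exact (mul_eq_zero.mp this).resolve_left (by positivity)

theorem sum_abs_placeLog {b : AlgModTorsion} (hb : b ∈ fieldSpace K) (T : Finset (FinitePlace K))
    (hT : ∀ v ∉ T, placeLog (Sum.inr v) b = 0) :
    ∑ w ∈ placesWith T, |placeLog w b| = Module.finrank ℚ K * ‖b‖ := by
  obtain ⟨n, hn, x, hx⟩ := exists_nsmul_eq_unitCls hb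
  have hn' : (n : ℝ) ≠ 0 := by positivity
  have h1 := sum_abs_logAt T x fun v hv => by rw [← placeLog_of_nsmul _ hx, hT v hv, mul_zero]
  rw [← finrank_mul_norm_unitCls, ← hx, norm_eq, h₁_nsmul] at h1
  simp only [← placeLog_of_nsmul _ hx, abs_mul, Nat.abs_cast, ← Finset.mul_sum] at h1
  refine mul_left_cancel₀ hn' (h1.trans ?_)
  rw [norm_eq]
  ring

theorem sum_placeLog {b : AlgModTorsion} (hb : b ∈ fieldSpace K) (T : Finset (FinitePlace K))
    (hT : ∀ v ∉ T, placeLog (Sum.inr v) b = 0) : ∑ w ∈ placesWith T, placeLog w b = 0 := by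
  obtain ⟨n, hn, x, hx⟩ := exists_nsmul_eq_unitCls hb
  have hn' : (n : ℝ) ≠ 0 := by positivity
  have h1 := sum_logAt T x fun v hv => by rw [← placeLog_of_nsmul _ hx, hT v hv, mul_zero]
  simp only [← placeLog_of_nsmul _ hx, ← Finset.mul_sum] at h1
  exact (mul_eq_zero.mp h1).resolve_left hn'

end Classes

/-! ### The spaces $V_{F,S}$ through local logarithms. -/

section SUnitSpace
variable {F K : IntermediateField ℚ Qbar} [FiniteDimensional ℚ F] [FiniteDimensional ℚ K]

theorem trivialAt_iff {b : AlgModTorsion} (hb : b ∈ fieldSpace K) (v : FinitePlace K) :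
    TrivialAt v.1 b ↔ placeLog (Sum.inr v) b = 0 := by
  constructor
  · rintro ⟨n, hn, x, hx, h, hv⟩
    obtain ⟨y, hy, e⟩ := cls_eq_unitCls hx
    have := placeLog_of_nsmul (Sum.inr v) (h.trans e)
    rw [logAt_inr_eq_zero.mpr (by rw [toMul_ofMul, hy]; exact hv)] at this
    exact (mul_eq_zero.mp this).resolve_left (by positivity)
  · intro h
    obtain ⟨n, hn, x, hx⟩ := exists_nsmul_eq_unitCls hb
    have := placeLog_of_nsmul (Sum.inr v) hx
    rw [h, mul_zero, eq_comm, logAt_inr_eq_zero] at this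
    exact ⟨n, hn, _, (x.toMul : K).2, hx, this⟩

theorem finite_placesOver (K : Type*) [Field K] [NumberField K] (S : Finset RatPlace) :
    {v : FinitePlace K | ∃ p : Nat.Primes, (p : RatPlace) ∈ S ∧ v (p : ℕ) < 1}.Finite := by
  have h1 : {v : FinitePlace K | ∃ p : Nat.Primes, (p : RatPlace) ∈ S ∧ v (p : ℕ) < 1} =
      ⋃ p ∈ {p : Nat.Primes | (p : RatPlace) ∈ S}, {v : FinitePlace K | v (p : ℕ) < 1} := by
    ext v; simp
  rw [h1]
  refine Set.Finite.biUnion ?_ fun p _ => ?_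
  · exact S.finite_toSet.preimage (WithTop.coe_injective.injOn)
  · refine (FinitePlace.hasFiniteMulSupport (K := K) (x := ((p : ℕ) : K)) ?_).subset fun v hv => ?_
    · exact_mod_cast p.2.ne_zero
    · exact (show v ((p : ℕ) : K) < 1 from hv).ne

/-- The finite places lying over the primes in `S`. -/
def placesOver (K : Type*) [Field K] [NumberField K] (S : Finset RatPlace) :
    Finset (FinitePlace K) := (finite_placesOver K S).toFinset

theorem mem_placesOver {K : Type*} [Field K] [NumberField K] {S : Finset RatPlace}
    {v : FinitePlace K} :
    v ∈ placesOver K S ↔ ∃ p : Nat.Primes, (p : RatPlace) ∈ S ∧ v (p : ℕ) < 1 := by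
  simp [placesOver]

/-- With $\infty\in S$ only finite places impose conditions, and each lies over exactly one rational
prime. -/
theorem mem_sUnitSpace_iff {S : Finset RatPlace} (hS : ⊤ ∈ S) {b : AlgModTorsion} :
    b ∈ sUnitSpace K S ↔
      b ∈ fieldSpace K ∧ ∀ v ∉ placesOver K S, placeLog (Sum.inr v : Place K) b = 0 := by
  constructor
  · rintro ⟨hb, h⟩
    refine ⟨hb, fun v hv => ?_⟩
    obtain ⟨p, hp⟩ := FinitePlace.exists_prime_lt_one v
    rw [← trivialAt_iff hb]
    exact h p v.1 (fun hpS => hv (mem_placesOver.mpr ⟨p, hpS, hp⟩)) ⟨v.isFinitePlace, hp⟩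
  · rintro ⟨hb, h⟩
    refine ⟨hb, fun p w hp hw => ?_⟩
    induction p using WithTop.recTopCoe with
    | top => exact absurd hS hp
    | coe p =>
      obtain ⟨hw, hlt⟩ := hw
      let v : FinitePlace K := ⟨w, hw⟩
      refine (trivialAt_iff hb v).mpr (h v fun hv => ?_)
      obtain ⟨q, hq, hvq⟩ := mem_placesOver.mp hv
      rw [FinitePlace.prime_unique v (show v (p : ℕ) < 1 from hlt) hvq] at hp
      exact hp hq

/-- The logarithms taken in $F$ and in $K$ are normalised by different local degrees, so only their
vanishing is compared. -/
theorem placeLog_eq_zero_iff_of_le (hle : F ≤ K) {b : AlgModTorsion} (hb : b ∈ fieldSpace F)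
    {v : FinitePlace F} {w : FinitePlace K}
    (hvw : ∀ x : F, w (IntermediateField.inclusion hle x) = 1 ↔ v x = 1) :
    placeLog (Sum.inr w) b = 0 ↔ placeLog (Sum.inr v) b = 0 := by
  obtain ⟨n, hn, x, hx⟩ := exists_nsmul_eq_unitCls hb
  have hn' : (n : ℝ) ≠ 0 := by positivity
  have hx' : n • b = unitCls K (Additive.ofMul
      (Units.map (IntermediateField.inclusion hle : F →* K) x.toMul)) :=
    hx.trans (congrArg cls (Units.ext rfl))
  have h1 := placeLog_of_nsmul (Sum.inr v) hx
  have h2 := placeLog_of_nsmul (Sum.inr w) hx'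
  rw [← mul_right_inj' hn', h2, mul_zero, ← mul_right_inj' hn' (b := placeLog _ b), h1, mul_zero,
    logAt_inr_eq_zero, logAt_inr_eq_zero]
  exact hvw _

/-- Every finite place of $F$ has one of $K$ above it and every one of $K$ has one below, over the
same prime. Hence all conditions can be tested at the places of the single field $K$. -/
theorem sUnitSpace_eq_inf (hle : F ≤ K) {S : Finset RatPlace} (hS : ⊤ ∈ S) :
    sUnitSpace F S = fieldSpace F ⊓ sUnitSpace K S := by
  let _ : Algebra F K := (IntermediateField.inclusion hle).toRingHom.toAlgebra
  ext b
  rw [Submodule.mem_inf, mem_sUnitSpace_iff hS, mem_sUnitSpace_iff hS]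
  have hp : ∀ p : Nat.Primes, algebraMap F K ((p : ℕ) : F) = ((p : ℕ) : K) := fun p =>
    map_natCast _ _
  constructor
  · rintro ⟨hb, h⟩
    refine ⟨hb, fieldSpace_mono hle hb, fun w hw => ?_⟩
    obtain ⟨v, hv⟩ := FinitePlace.exists_below F w
    rw [placeLog_eq_zero_iff_of_le hle hb fun x => (hv x).1]
    refine h v fun hmem => hw ?_
    obtain ⟨p, hpS, hlt⟩ := mem_placesOver.mp hmem
    exact mem_placesOver.mpr ⟨p, hpS, by rw [← hp, (hv _).2]; exact hlt⟩
  · rintro ⟨hb, -, h⟩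
    refine ⟨hb, fun v hv => ?_⟩
    obtain ⟨w, hw⟩ := FinitePlace.exists_above K v
    rw [← placeLog_eq_zero_iff_of_le hle hb fun x => (hw x).1]
    refine h w fun hmem => hv ?_
    obtain ⟨p, hpS, hlt⟩ := mem_placesOver.mp hmem
    exact mem_placesOver.mpr ⟨p, hpS, by rw [← (hw _).2, hp]; exact hlt⟩

theorem exists_sUnitSpace_mem {b : AlgModTorsion} (hb : b ∈ fieldSpace K) :
    ∃ S : Finset RatPlace, ⊤ ∈ S ∧ b ∈ sUnitSpace K S := by
  classical
  obtain ⟨T, hT⟩ := exists_support_placeLog hb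
  choose p hp using fun v : FinitePlace K => FinitePlace.exists_prime_lt_one v
  refine ⟨insert ⊤ (T.image fun v => (p v : RatPlace)), Finset.mem_insert_self _ _, ?_⟩
  rw [mem_sUnitSpace_iff (Finset.mem_insert_self _ _)]
  refine ⟨hb, fun v hv => hT v fun hvT => hv ?_⟩
  exact mem_placesOver.mpr ⟨p v, Finset.mem_insert_of_mem (Finset.mem_image_of_mem _ hvT), hp v⟩

/-- Generation up to powers suffices, since exponents can be divided out in a rational vector space.
-/
theorem finiteDimensional_sUnitSpace {S : Finset RatPlace} (hS : ⊤ ∈ S) :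
    FiniteDimensional ℚ (sUnitSpace K S) := by
  classical
  obtain ⟨g, -, h, hh, hgen⟩ := sUnits_almost_fg (placesOver K S)
  let W := Submodule.span ℚ (g.image fun y => unitCls K (Additive.ofMul y) : Set AlgModTorsion)
  have hW : FiniteDimensional ℚ W := FiniteDimensional.span_finset ℚ _
  refine Submodule.finiteDimensional_of_le (S₂ := W) fun b hb => ?_
  obtain ⟨hb, hv⟩ := (mem_sUnitSpace_iff hS).mp hb
  obtain ⟨n, hn, x, hx⟩ := exists_nsmul_eq_unitCls hb
  have hxS : x.toMul ∈ sUnits (placesOver K S : Set (FinitePlace K)) := fun v hv' =>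
    logAt_inr_eq_zero.mp (by rw [← placeLog_of_nsmul _ hx, hv v (by simpa using hv'), mul_zero])
  have hmem : ∀ y ∈ Subgroup.closure (g : Set Kˣ), unitCls K (Additive.ofMul y) ∈ W := by
    intro y hy
    induction hy using Subgroup.closure_induction with
    | mem y hy => exact Submodule.subset_span (by simpa using ⟨y, hy, rfl⟩)
    | one => rw [ofMul_one, map_zero]; exact zero_mem _
    | mul y z _ _ hy hz => rw [ofMul_mul, map_add]; exact add_mem hy hz
    | inv y _ hy => rw [ofMul_inv, map_neg]; exact neg_mem hy
  have h1 := hmem _ (hgen _ hxS)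
  rw [ofMul_pow, ofMul_toMul, map_nsmul, ← hx, smul_smul, ← Nat.cast_smul_eq_nsmul ℚ] at h1
  exact (Submodule.smul_mem_iff W (by exact_mod_cast mul_ne_zero hh hn)).mp h1

end SUnitSpace

instance : IsAlgClosure ℚ Qbar := ⟨inferInstance, inferInstance⟩

/-! ### The Galois action on classes. -/

section Action

/-- The action of a field automorphism on classes modulo torsion. -/
def galAct (τ : Gal(Qbar/ℚ)) : AlgModTorsion →ₗ[ℚ] AlgModTorsion :=
  AddMonoidHom.toRatLinearMap <| MonoidHom.toAdditive <|
    QuotientGroup.map (CommGroup.torsion Qbarˣ) (CommGroup.torsion Qbarˣ)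
      (Units.map (τ : Qbar →* Qbar)) fun x hx => by
        obtain ⟨n, hn, h⟩ := isOfFinOrder_iff_pow_eq_one.mp hx
        exact isOfFinOrder_iff_pow_eq_one.mpr ⟨n, hn, by rw [← map_pow, h, map_one]⟩

theorem galAct_cls (τ : Gal(Qbar/ℚ)) (x : Qbarˣ) :
    galAct τ (cls x) = cls (Units.map (τ : Qbar →* Qbar) x) := rfl

theorem norm_galAct (τ : Gal(Qbar/ℚ)) (b : AlgModTorsion) : ‖galAct τ b‖ = ‖b‖ := by
  obtain ⟨x, rfl⟩ := cls_surjective b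
  rw [galAct_cls, norm_eq, norm_eq, h₁_cls, h₁_cls]
  let E := IntermediateField.adjoin ℚ {(x : Qbar)}
  let F := IntermediateField.adjoin ℚ {τ (x : Qbar)}
  have hmap : E.map (τ : Qbar →ₐ[ℚ] Qbar) = F := by
    rw [IntermediateField.adjoin_map, Set.image_singleton]; rfl
  have hle : ∀ y : E, τ y ∈ F := fun y => by
    rw [← hmap]; exact ⟨y, y.2, rfl⟩
  let j : E →+* F := (τ.toRingEquiv.toRingHom.comp E.val.toRingHom).codRestrict F hle
  -- With $\tau$ as structure map, conjugation invariance becomes an instance of independence of the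
  -- field in which the height is computed.
  let _ := j.toAlgebra
  have h0 : IntermediateField.AdjoinSimple.gen ℚ (x : Qbar) ≠ 0 := fun h => by
    have := congrArg Subtype.val h
    simp at this
  have h1 : algebraMap E F (IntermediateField.AdjoinSimple.gen ℚ (x : Qbar)) ≠ 0 :=
    (map_ne_zero _).mpr h0
  exact (weilHeight_eq F h1).trans (heightIn_algebraMap (L := F) h0)

theorem galAct_eq_self {E : IntermediateField ℚ Qbar} {τ : Gal(Qbar/ℚ)} (hτ : ∀ x ∈ E, τ x = x)
    {b : AlgModTorsion} (hb : b ∈ fieldSpace E) : galAct τ b = b := by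
  have : fieldSpace E ≤ LinearMap.eqLocus (galAct τ) LinearMap.id := by
    rw [fieldSpace, Submodule.span_le]
    rintro _ ⟨x, hx, rfl⟩
    change galAct τ (cls x) = cls x
    rw [galAct_cls]
    exact congrArg cls (Units.ext (hτ x hx))
  exact this hb

theorem mem_of_forall_galois {E : IntermediateField ℚ Qbar} {x : Qbar}
    (hx : ∀ τ : Gal(Qbar/ℚ), (∀ y ∈ E, τ y = y) → τ x = x) : x ∈ E := by
  rw [← InfiniteGalois.fixedField_fixingSubgroup E, IntermediateField.mem_fixedField_iff]
  exact fun τ hτ => hx τ ((IntermediateField.mem_fixingSubgroup_iff E τ).mp hτ)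

end Action

/-! ### Averaging over Galois groups. -/

section Average
variable (N E : IntermediateField ℚ Qbar)

/-- The automorphisms of `N` fixing `N ∩ E` pointwise. -/
def fixer : Subgroup Gal(N/ℚ) where
  carrier := {g | ∀ y : N, (y : Qbar) ∈ E → g y = y}
  one_mem' _ _ := rfl
  mul_mem' {g h} hg hh y hy := by rw [AlgEquiv.mul_apply, hh y hy, hg y hy]
  inv_mem' {g} hg y hy := by
    change g.symm y = y
    rw [AlgEquiv.symm_apply_eq, hg y hy]

variable {N E} in
theorem mem_fixer {g : Gal(N/ℚ)} : g ∈ fixer N E ↔ ∀ y : N, (y : Qbar) ∈ E → g y = y := Iff.rfl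

variable {N E} in
theorem fixer_anti {F : IntermediateField ℚ Qbar} (h : E ≤ F) : fixer N F ≤ fixer N E :=
  fun _ hg y hy => hg y (h hy)

/-- An extension of an automorphism of `N` to `ℚ̄`. -/
def liftGal (g : Gal(N/ℚ)) : Gal(Qbar/ℚ) := g.liftNormal Qbar

variable {N} in
theorem liftGal_apply (g : Gal(N/ℚ)) (y : N) : liftGal N g (y : Qbar) = g y :=
  AlgEquiv.liftNormal_commutes g Qbar y

variable {N} in
theorem restrictNormal_apply [Normal ℚ N] (τ : Gal(Qbar/ℚ)) (y : N) :
    ((τ.restrictNormal N y : N) : Qbar) = τ y :=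
  AlgEquiv.restrictNormal_commutes τ N y

variable {N E} in
theorem galAct_liftGal_unitCls (g : Gal(N/ℚ)) (y : Nˣ) :
    galAct (liftGal N g) (unitCls N (Additive.ofMul y)) =
      unitCls N (Additive.ofMul (Units.map (g : N →* N) y)) :=
  congrArg cls (Units.ext (liftGal_apply g (y : N)))

variable {N E} in
theorem restrictNormal_mem_fixer [Normal ℚ N] {τ : Gal(Qbar/ℚ)} (hτ : ∀ x ∈ E, τ x = x) :
    τ.restrictNormal N ∈ fixer N E := fun y hy =>
  Subtype.ext ((restrictNormal_apply τ y).trans (hτ y hy))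

variable {N} in
-- Automorphisms of $N$ preserve $N\cap K$ because $K$ is normal, so conjugation preserves the
-- pointwise stabiliser.
theorem fixer_normal {K : IntermediateField ℚ Qbar} [Normal ℚ K] : (fixer N K).Normal where
  conj_mem g hg t y hy := by
    have h1 : ((t⁻¹ y : N) : Qbar) ∈ K := by
      rw [← liftGal_apply, ← restrictNormal_apply (N := K) (liftGal N t⁻¹) ⟨y, hy⟩]
      exact Subtype.prop _
    rw [AlgEquiv.mul_apply, AlgEquiv.mul_apply, hg _ h1]
    exact t.apply_symm_apply y

variable [FiniteDimensional ℚ N]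

theorem card_fixer_mul_finrank [IsGalois ℚ N] (hle : E ≤ N) :
    Nat.card (fixer N E) * Module.finrank ℚ E = Module.finrank ℚ N := by
  have h : fixer N E = (IntermediateField.restrict hle).fixingSubgroup := by
    ext g
    exact ⟨fun h => (IntermediateField.mem_fixingSubgroup_iff _ g).mpr fun y hy =>
        h y ((IntermediateField.mem_restrict hle y).mp hy),
      fun h y hy => (IntermediateField.mem_fixingSubgroup_iff _ g).mp h y
        ((IntermediateField.mem_restrict hle y).mpr hy)⟩
  have h1 : Nat.card (fixer N E) = Module.finrank (IntermediateField.restrict hle) N := by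
    rw [h]
    exact IsGalois.card_fixingSubgroup_eq_finrank _
  have h2 : Module.finrank ℚ E = Module.finrank ℚ (IntermediateField.restrict hle) :=
    (IntermediateField.restrictAlgEquiv hle).toLinearEquiv.finrank_eq
  rw [h1, h2, mul_comm]
  exact Module.finrank_mul_finrank ℚ (IntermediateField.restrict hle) N

instance : Fintype (fixer N E) := Fintype.ofFinite _

/-- The average over the automorphisms of `N` fixing `N ∩ E`. -/
def average : AlgModTorsion →ₗ[ℚ] AlgModTorsion :=
  (Fintype.card (fixer N E) : ℚ)⁻¹ • ∑ g : fixer N E, galAct (liftGal N g)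

theorem average_apply (b : AlgModTorsion) : average N E b =
    (Fintype.card (fixer N E) : ℚ)⁻¹ • ∑ g : fixer N E, galAct (liftGal N g) b := by
  simp [average]

theorem card_fixer_ne_zero : (Fintype.card (fixer N E) : ℚ) ≠ 0 := by
  exact_mod_cast Fintype.card_ne_zero

theorem norm_average_le (b : AlgModTorsion) : ‖average N E b‖ ≤ ‖b‖ := by
  have hc : (0 : ℝ) < Fintype.card (fixer N E) := by exact_mod_cast Fintype.card_pos
  rw [average_apply, norm_smul]
  calc _ ≤ ‖(Fintype.card (fixer N E) : ℚ)⁻¹‖ * (Fintype.card (fixer N E) * ‖b‖) := by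
        gcongr
        refine (norm_sum_le _ _).trans ?_
        simp [norm_galAct]
    _ = ‖b‖ := by
        rw [norm_inv, ← Rat.norm_cast_real, Rat.cast_natCast, Real.norm_natCast]
        field_simp

variable {N E}

theorem average_eq_self (hle : E ≤ N) {b : AlgModTorsion} (hb : b ∈ fieldSpace E) :
    average N E b = b := by
  have : ∀ g : fixer N E, galAct (liftGal N g) b = b := fun g =>
    galAct_eq_self (fun x hx => by
      have := liftGal_apply (g : Gal(N/ℚ)) ⟨x, hle hx⟩
      rw [g.2 _ hx] at this
      exact this) hb
  rw [average_apply, Finset.sum_congr rfl fun g _ => this g, Finset.sum_const, Finset.card_univ,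
    ← Nat.cast_smul_eq_nsmul ℚ, smul_smul, inv_mul_cancel₀ (card_fixer_ne_zero N E), one_smul]

variable (E) in
/-- The product of the conjugates of `y` under the automorphisms fixing `N ∩ E`. -/
def fixerNorm (y : Nˣ) : Nˣ := ∏ g : fixer N E, Units.map ((g : Gal(N/ℚ)) : N →* N) y

theorem average_unitCls (y : Nˣ) : average N E (unitCls N (Additive.ofMul y)) =
    (Fintype.card (fixer N E) : ℚ)⁻¹ • unitCls N (Additive.ofMul (fixerNorm E y)) := by
  rw [average_apply, fixerNorm, ofMul_prod, map_sum]
  simp only [galAct_liftGal_unitCls]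

theorem map_fixerNorm (t : Gal(N/ℚ)) (y : Nˣ) :
    t (fixerNorm E y : N) = ∏ g : fixer N E, (t * g) (y : N) := by
  simp only [fixerNorm, Units.coe_prod, map_prod]
  rfl

theorem fixerNorm_eq_prod (y : Nˣ) :
    (fixerNorm E y : N) = ∏ g : fixer N E, (g : Gal(N/ℚ)) (y : N) := by
  simp only [fixerNorm, Units.coe_prod]
  rfl

theorem map_fixerNorm_of_mem {t : Gal(N/ℚ)} (ht : t ∈ fixer N E) (y : Nˣ) :
    t (fixerNorm E y : N) = fixerNorm E y := by
  rw [map_fixerNorm, fixerNorm_eq_prod,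
    ← Equiv.prod_comp (Equiv.mulLeft (⟨t, ht⟩ : fixer N E)) fun g => (g : Gal(N/ℚ)) (y : N)]
  rfl

/-- $t\prod_g g(y)=\prod_g(tgt^{-1})(ty)$, and conjugation by $t$ only permutes the factors. -/
theorem map_fixerNorm_of_fixed [(fixer N E).Normal] {t : Gal(N/ℚ)} {y : Nˣ}
    (ht : t (y : N) = y) : t (fixerNorm E y : N) = fixerNorm E y := by
  rw [map_fixerNorm, fixerNorm_eq_prod,
    ← Equiv.prod_comp (MulAut.conjNormal (H := fixer N E) t).toEquiv
      fun g => (g : Gal(N/ℚ)) (y : N)]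
  refine Finset.prod_congr rfl fun g _ => ?_
  change (t * (g : Gal(N/ℚ))) (y : N) = ((MulAut.conjNormal t g : fixer N E) : Gal(N/ℚ)) (y : N)
  rw [MulAut.conjNormal_apply, AlgEquiv.mul_apply (t * (g : Gal(N/ℚ))) t⁻¹]
  congr 1
  change _ = t.symm _
  rw [AlgEquiv.eq_symm_apply, ht]

theorem fixerNorm_mem [Normal ℚ N] (y : Nˣ) : ((fixerNorm E y : N) : Qbar) ∈ E :=
  mem_of_forall_galois fun τ hτ => by
    rw [← restrictNormal_apply, map_fixerNorm_of_mem (restrictNormal_mem_fixer hτ)]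

theorem average_mem [Normal ℚ N] {b : AlgModTorsion} (hb : b ∈ fieldSpace N) :
    average N E b ∈ fieldSpace E := by
  have : fieldSpace N ≤ (fieldSpace E).comap (average N E) := by
    rw [fieldSpace_eq_span, Submodule.span_le]
    rintro _ ⟨y, rfl⟩
    change average N E (unitCls N (Additive.ofMul y.toMul)) ∈ fieldSpace E
    rw [average_unitCls]
    exact Submodule.smul_mem _ _ (cls_mem_fieldSpace (fixerNorm_mem y.toMul))
  exact this hb

/-- The product of conjugates over $N\cap K$ lies in $K$. Normality of $K$ also makes it fixed by
every automorphism that fixes $L$ pointwise, since these fix $x$. This is where the degree drops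
from $[L:\mathbb Q]$ to $[K\cap L:\mathbb Q]$. -/
theorem average_cls_mem_inf [Normal ℚ N] {K L : IntermediateField ℚ Qbar} [Normal ℚ K]
    {x : Qbarˣ} (hxN : (x : Qbar) ∈ N) (hxL : (x : Qbar) ∈ L) :
    average N K (cls x) ∈ fieldSpace (K ⊓ L) := by
  have := fixer_normal (N := N) (K := K)
  obtain ⟨y, hy, e⟩ := cls_eq_unitCls hxN
  rw [e, average_unitCls]
  refine Submodule.smul_mem _ _ (cls_mem_fieldSpace ⟨fixerNorm_mem y, ?_⟩)
  refine mem_of_forall_galois fun τ hτ => ?_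
  have h1 : τ.restrictNormal N (y : N) = y := Subtype.ext (by
    rw [restrictNormal_apply, hy]
    exact hτ _ hxL)
  exact (restrictNormal_apply τ _).symm.trans (congrArg Subtype.val (map_fixerNorm_of_fixed h1))

theorem placeLog_galAct {b : AlgModTorsion} (hb : b ∈ fieldSpace N) (g : Gal(N/ℚ)) (w : Place N) :
    placeLog w (galAct (liftGal N g) b) = placeLog (g⁻¹ • w) b := by
  have : fieldSpace N ≤ LinearMap.eqLocus ((placeLog w).comp (galAct (liftGal N g)))
      (placeLog (g⁻¹ • w)) := by
    rw [fieldSpace_eq_span, Submodule.span_le]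
    rintro _ ⟨y, rfl⟩
    change placeLog w (galAct (liftGal N g) (unitCls N (Additive.ofMul y.toMul))) =
      placeLog (g⁻¹ • w) (unitCls N y)
    rw [galAct_liftGal_unitCls, placeLog_unitCls, placeLog_unitCls, logAt_smul]
    rfl
  exact this hb

theorem placeLog_smul_of_mem_fixer (hle : E ≤ N) {b : AlgModTorsion} (hb : b ∈ fieldSpace E)
    {g : Gal(N/ℚ)} (hg : g ∈ fixer N E) (w : Place N) :
    placeLog (g • w) b = placeLog w b := by
  have h : galAct (liftGal N g⁻¹) b = b := galAct_eq_self (fun x hx => by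
    have := liftGal_apply g⁻¹ ⟨x, hle hx⟩
    rw [(fixer N E).inv_mem hg _ hx] at this
    exact this) hb
  rw [← inv_inv g, ← placeLog_galAct (fieldSpace_mono hle hb), h]

theorem placeLog_average {b : AlgModTorsion} (hb : b ∈ fieldSpace N) (w : Place N) :
    placeLog w (average N E b) =
      (Fintype.card (fixer N E) : ℝ)⁻¹ * ∑ g : fixer N E, placeLog ((g : Gal(N/ℚ)) • w) b := by
  rw [average_apply, map_smul, map_sum, Rat.smul_def]
  push_cast
  congr 1
  rw [← Equiv.sum_comp (Equiv.inv (fixer N E))]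
  refine Finset.sum_congr rfl fun g _ => ?_
  rw [placeLog_galAct hb]
  simp

end Average

/-! ### The extremal norm through decompositions over subfields of $K$. -/

section Decomposition
variable {K : IntermediateField ℚ Qbar} [FiniteDimensional ℚ K]

theorem exists_rep_minDegree (b : AlgModTorsion) : ∃ x : Qbarˣ, cls x = b ∧
    minDegree b = Module.finrank ℚ (IntermediateField.adjoin ℚ {(x : Qbar)}) := by
  obtain ⟨x, hx⟩ := cls_surjective b
  exact Nat.sInf_mem (s := {n | ∃ x : Qbarˣ, cls x = b ∧
    n = Module.finrank ℚ (IntermediateField.adjoin ℚ {(x : Qbar)})}) ⟨_, x, hx, rfl⟩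

/-- A representation by arbitrary classes can be replaced by one over the subfields of `K`. -/
theorem exists_subfield_decomposition [IsGalois ℚ K] {α : AlgModTorsion} (hα : α ∈ fieldSpace K) {n : ℕ}
    (r : Fin n → ℚ) (b : Fin n → AlgModTorsion) (hsum : α = ∑ i, r i • b i) :
    ∃ β : Set.Iic K → AlgModTorsion, (∀ F, β F ∈ fieldSpace F.1) ∧ α = ∑ F, β F ∧
      ∑ F : Set.Iic K, (Module.finrank ℚ F.1 : ℝ) * ‖β F‖ ≤ ∑ i, |(r i : ℝ)| * mahler₁ (b i) := by
  classical
  choose x hx hdeg using fun i => exists_rep_minDegree (b i)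
  let L : Fin n → IntermediateField ℚ Qbar := fun i => IntermediateField.adjoin ℚ {(x i : Qbar)}
  let M := K ⊔ ⨆ i, L i
  have hM : FiniteDimensional ℚ M := inferInstance
  -- A finite normal field containing $K$ and all the chosen representatives, in which the averages
  -- can be formed.
  let N := IntermediateField.normalClosure ℚ M Qbar
  have hMN : M ≤ N := IntermediateField.le_normalClosure M
  have hN : FiniteDimensional ℚ N := inferInstance
  have hNn : Normal ℚ N := normalClosure.normal ℚ M Qbar
  have hxL : ∀ i, (x i : Qbar) ∈ L i := fun i => IntermediateField.mem_adjoin_simple_self ℚ _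
  have hxN : ∀ i, (x i : Qbar) ∈ N := fun i =>
    hMN ((le_sup_right : _ ≤ M) (le_iSup L i (hxL i)))
  -- The averaged terms are grouped by the subfield $K\cap\mathbb Q(x_i)$ in which they land.
  let Φ : Fin n → Set.Iic K := fun i => ⟨K ⊓ L i, (inf_le_left : K ⊓ L i ≤ K)⟩
  have hmem : ∀ i, average N K (b i) ∈ fieldSpace (Φ i).1 := fun i => by
    rw [← hx i]; exact average_cls_mem_inf (hxN i) (hxL i)
  refine ⟨fun F => ∑ i with Φ i = F, r i • average N K (b i), fun F => ?_, ?_, ?_⟩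
  · refine Submodule.sum_mem _ fun i hi => Submodule.smul_mem _ _ ?_
    rw [← (Finset.mem_filter.mp hi).2]
    exact hmem i
  · rw [Finset.sum_fiberwise, ← average_eq_self (le_sup_left.trans hMN) hα]
    conv_lhs => rw [hsum, map_sum]
    simp only [map_smul]
  · calc ∑ F : Set.Iic K, (Module.finrank ℚ F.1 : ℝ) * ‖∑ i with Φ i = F, r i • average N K (b i)‖
        ≤ ∑ F : Set.Iic K, ∑ i with Φ i = F, |(r i : ℝ)| * mahler₁ (b i) := by
          refine Finset.sum_le_sum fun F _ => ?_
          refine (mul_le_mul_of_nonneg_left (norm_sum_le _ _) (Nat.cast_nonneg _)).trans ?_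
          rw [Finset.mul_sum]
          refine Finset.sum_le_sum fun i hi => ?_
          obtain rfl := (Finset.mem_filter.mp hi).2
          have h1 : (Module.finrank ℚ (Φ i).1 : ℝ) ≤ minDegree (b i) := by
            rw [hdeg]
            exact_mod_cast IntermediateField.finrank_le_of_le_right
              (inf_le_right : K ⊓ L i ≤ L i)
          rw [norm_smul, ← Rat.norm_cast_real, Real.norm_eq_abs, mul_left_comm, mahler₁,
            ← norm_eq]
          gcongr
          exact norm_average_le N K _
      _ = _ := Finset.sum_fiberwise ..

theorem mahler₁_nonneg (b : AlgModTorsion) : 0 ≤ mahler₁ b :=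
  mul_nonneg (Nat.cast_nonneg _) (by rw [← norm_eq]; exact norm_nonneg _)

/-- An element of $V_F$ need not have a representative in $F$, but a multiple of it does, of degree
at most $[F:\mathbb Q]$. The rational coefficients in the definition of the norm absorb the
multiple. -/
theorem extremalNorm₁_le {α : AlgModTorsion} (β : Set.Iic K → AlgModTorsion)
    (hβ : ∀ F, β F ∈ fieldSpace F.1) (hsum : α = ∑ F, β F) :
    extremalNorm₁ α ≤ ∑ F : Set.Iic K, (Module.finrank ℚ F.1 : ℝ) * ‖β F‖ := by
  choose n hn y hy using fun F => exists_nsmul_eq_unitCls (hβ F)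
  let e := Fintype.equivFin (Set.Iic K)
  have hb : ∀ F, β F = (n F : ℚ)⁻¹ • unitCls F.1 (y F) := fun F => by
    rw [← hy, ← Nat.cast_smul_eq_nsmul ℚ, inv_smul_smul₀ (by exact_mod_cast hn F)]
  have hle : ∑ F : Set.Iic K, |(((n F : ℚ)⁻¹ : ℚ) : ℝ)| * mahler₁ (unitCls F.1 (y F)) ≤
      ∑ F : Set.Iic K, (Module.finrank ℚ F.1 : ℝ) * ‖β F‖ := by
    refine Finset.sum_le_sum fun F _ => ?_
    have h1 : (minDegree (unitCls F.1 (y F)) : ℝ) ≤ Module.finrank ℚ F.1 := by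
      have h2 : minDegree (unitCls F.1 (y F)) ≤ Module.finrank ℚ
          (IntermediateField.adjoin ℚ {(((y F).toMul : F.1) : Qbar)}) :=
        Nat.sInf_le ⟨_, rfl, rfl⟩
      have h3 := IntermediateField.finrank_le_of_le_right
        (IntermediateField.adjoin_simple_le_iff.mpr ((y F).toMul : F.1).2)
      exact_mod_cast h2.trans h3
    conv_rhs => rw [hb F]
    rw [norm_smul, ← Rat.norm_cast_real, Real.norm_eq_abs, mahler₁, ← norm_eq, mul_left_comm]
    gcongr
  refine le_trans (csInf_le ⟨0, ?_⟩ ⟨_, fun i => (n (e.symm i) : ℚ)⁻¹,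
    fun i => unitCls (e.symm i).1 (y (e.symm i)), ?_, rfl⟩) ?_
  · rintro _ ⟨m, r, b, -, rfl⟩
    exact Finset.sum_nonneg fun i _ => mul_nonneg (abs_nonneg _) (mahler₁_nonneg _)
  · rw [hsum, ← Equiv.sum_comp e.symm]
    exact Finset.sum_congr rfl fun i _ => hb _
  · rw [Equiv.sum_comp e.symm fun F : Set.Iic K =>
      |(((n F : ℚ)⁻¹ : ℚ) : ℝ)| * mahler₁ (unitCls F.1 (y F))]
    exact hle

end Decomposition

/-! ### Logarithm vectors as coordinates on the completions. -/

section Realization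
variable {K : IntermediateField ℚ Qbar} [FiniteDimensional ℚ K]

variable (K) in
/-- The vector of all local logarithms of a class. -/
def logVec : AlgModTorsion →ₗ[ℚ] (Place K → ℝ) := LinearMap.pi fun w => placeLog w

theorem logVec_apply (b : AlgModTorsion) (w : Place K) : logVec K b w = placeLog w b := rfl

variable (K) in
/-- The real span of the logarithm vectors of `V_{E,S}`. -/
def logSpan (E : IntermediateField ℚ Qbar) [FiniteDimensional ℚ E] (S : Finset RatPlace) :
    Submodule ℝ (Place K → ℝ) := Submodule.span ℝ (logVec K '' sUnitSpace E S)

variable {E F : IntermediateField ℚ Qbar} [FiniteDimensional ℚ E] [FiniteDimensional ℚ F]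
  {S : Finset RatPlace}

theorem sUnitSpace_mono (hS : ⊤ ∈ S) (h : E ≤ F) : sUnitSpace E S ≤ sUnitSpace F S := by
  rw [sUnitSpace_eq_inf h hS]; exact inf_le_right

theorem logSpan_mono (hS : ⊤ ∈ S) (h : E ≤ F) : logSpan K E S ≤ logSpan K F S :=
  Submodule.span_mono (Set.image_mono (sUnitSpace_mono hS h))

theorem coe_mem_sUnitCompletion {b : AlgModTorsion} (hb : b ∈ sUnitSpace E S) :
    (b : CompletedSpace) ∈ sUnitCompletion E S := subset_closure ⟨b, hb, rfl⟩

theorem placeLog_eq_zero_of_mem (hS : ⊤ ∈ S) {b : AlgModTorsion} (hb : b ∈ sUnitSpace K S) :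
    ∀ v ∉ placesOver K S, placeLog (Sum.inr v : Place K) b = 0 :=
  ((mem_sUnitSpace_iff hS).mp hb).2

/-- The Galois action permutes the places over each prime, so averaging keeps the support over $S$.
-/
theorem average_mem_sUnitSpace [IsGalois ℚ K] (hS : ⊤ ∈ S) (hle : E ≤ K) {b : AlgModTorsion}
    (hb : b ∈ sUnitSpace K S) : average K E b ∈ sUnitSpace E S := by
  have hbK := ((mem_sUnitSpace_iff hS).mp hb).1
  have hE : average K E b ∈ fieldSpace E := average_mem hbK
  rw [sUnitSpace_eq_inf hle hS, Submodule.mem_inf, mem_sUnitSpace_iff hS]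
  refine ⟨hE, fieldSpace_mono hle hE, fun v hv => ?_⟩
  rw [placeLog_average hbK, Finset.sum_eq_zero, mul_zero]
  intro g _
  refine placeLog_eq_zero_of_mem hS hb _ fun hmem => hv ?_
  obtain ⟨p, hpS, hp⟩ := mem_placesOver.mp hmem
  refine mem_placesOver.mpr ⟨p, hpS, ?_⟩
  rw [FinitePlace.smul_apply, map_natCast] at hp
  exact hp

theorem smul_mem_placesOver {g : Gal(K/ℚ)} {v : FinitePlace K} :
    g • v ∈ placesOver K S ↔ v ∈ placesOver K S := by
  simp only [mem_placesOver, FinitePlace.smul_apply, map_natCast]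

theorem smul_mem_placesWith (g : Gal(K/ℚ)) {w : Place K} :
    g • w ∈ placesWith (placesOver K S) ↔ w ∈ placesWith (placesOver K S) := by
  rcases w with v | v
  · exact iff_of_true (inl_mem_placesWith ..) (inl_mem_placesWith ..)
  · rw [Sum.smul_inr, inr_mem_placesWith, inr_mem_placesWith, smul_mem_placesOver]

/-- The `S`-unit theorem for a subfield `E`: the span of the logarithm vectors of `V_{E,S}`. -/
theorem mem_logSpan_iff [IsGalois ℚ K] (hS : ⊤ ∈ S) (hle : E ≤ K) {f : Place K → ℝ} :
    f ∈ logSpan K E S ↔ (∀ v ∉ placesOver K S, f (Sum.inr v) = 0) ∧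
      ∑ w ∈ placesWith (placesOver K S), f w = 0 ∧ ∀ g ∈ fixer K E, ∀ w, f (g • w) = f w := by
  constructor
  · intro hf
    induction hf using Submodule.span_induction with
    | mem f hf =>
      obtain ⟨b, hb, rfl⟩ := hf
      have hb' := sUnitSpace_mono hS hle hb
      exact ⟨placeLog_eq_zero_of_mem hS hb', sum_placeLog hb'.1 _ (placeLog_eq_zero_of_mem hS hb'),
        fun g hg w => placeLog_smul_of_mem_fixer hle hb.1 hg w⟩
    | zero => simp
    | add f f' _ _ h h' =>
      refine ⟨fun v hv => by simp [h.1 v hv, h'.1 v hv], ?_, fun g hg w => ?_⟩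
      · simp [Finset.sum_add_distrib, h.2.1, h'.2.1]
      · simp [h.2.2 g hg, h'.2.2 g hg]
    | smul c f _ h =>
      refine ⟨fun v hv => by simp [h.1 v hv], ?_, fun g hg w => ?_⟩
      · simp [← Finset.mul_sum, h.2.1]
      · simp [h.2.2 g hg]
  · rintro ⟨h1, h2, h3⟩
    have hc : (Fintype.card (fixer K E) : ℝ) ≠ 0 := by exact_mod_cast Fintype.card_ne_zero
    -- $A$ is the projection onto invariant vectors. It maps logarithm vectors of $S$-units of $K$
    -- to those of their averages, so the case of $E$ follows from `mem_span_logAt` for $K$.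
    let A : (Place K → ℝ) →ₗ[ℝ] (Place K → ℝ) :=
      (Fintype.card (fixer K E) : ℝ)⁻¹ • ∑ g : fixer K E, LinearMap.funLeft ℝ ℝ ((g : Gal(K/ℚ)) • ·)
    have hA : ∀ f w, A f w = (Fintype.card (fixer K E) : ℝ)⁻¹ *
        ∑ g : fixer K E, f ((g : Gal(K/ℚ)) • w) := fun f w => by
      simp [A, LinearMap.funLeft_apply]
    have hAf : A f = f := by
      ext w
      rw [hA, Finset.sum_congr rfl fun g _ => h3 g.1 g.2 w, Finset.sum_const, Finset.card_univ,
        nsmul_eq_mul, inv_mul_cancel_left₀ hc]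
    have hle' : Submodule.span ℝ {u : Place K → ℝ |
        ∃ y ∈ sUnits (placesOver K S : Set (FinitePlace K)),
          u = fun w => logAt w (Additive.ofMul y)} ≤ (logSpan K E S).comap A := by
      rw [Submodule.span_le]
      rintro _ ⟨y, hy, rfl⟩
      have hyS : unitCls K (Additive.ofMul y) ∈ sUnitSpace K S :=
        (mem_sUnitSpace_iff hS).mpr ⟨unitCls_mem K _, fun v hv => by
          rw [placeLog_unitCls, logAt_inr_eq_zero]
          exact hy v (by simpa using hv)⟩
      refine Submodule.subset_span ⟨_, average_mem_sUnitSpace hS hle hyS, ?_⟩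
      ext w
      rw [logVec_apply, placeLog_average (unitCls_mem K _), hA]
      simp only [placeLog_unitCls]
    rw [← hAf]
    exact hle' (mem_span_logAt _ f h1 h2)

/-- Logarithm vectors determine elements of the completion, isometrically up to the degree. -/
theorem exists_realization (hS : ⊤ ∈ S) : FiniteDimensional ℝ (logSpan K K S) ∧
    ∃ ρ : (Place K → ℝ) →ₗ[ℝ] CompletedSpace,
      (∀ f ∈ logSpan K K S, Module.finrank ℚ K * ‖ρ f‖ = ∑ w ∈ placesWith (placesOver K S), |f w|) ∧
      ∀ b ∈ sUnitSpace K S, ρ (logVec K b) = b := by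
  have hfd := finiteDimensional_sUnitSpace (K := K) hS
  let e := Module.finBasis ℚ (sUnitSpace K S)
  let r := Module.finrank ℚ (sUnitSpace K S)
  have hK : (0 : ℝ) < Module.finrank ℚ K := mod_cast Module.finrank_pos
  let Λ : (Fin r → ℝ) →ₗ[ℝ] (Place K → ℝ) :=
    Fintype.linearCombination ℝ fun i => logVec K (e i : AlgModTorsion)
  let τ : (Fin r → ℝ) →ₗ[ℝ] CompletedSpace :=
    Fintype.linearCombination ℝ fun i => ((e i : AlgModTorsion) : CompletedSpace)
  let comb : (Fin r → ℚ) → AlgModTorsion := fun q => ∑ i, q i • (e i : AlgModTorsion)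
  have hcomb : ∀ q, comb q ∈ sUnitSpace K S := fun q =>
    Submodule.sum_mem _ fun i _ => Submodule.smul_mem _ _ (e i).2
  have hΛq : ∀ q : Fin r → ℚ, Λ (fun i => (q i : ℝ)) = logVec K (comb q) := fun q => by
    simp only [Λ, comb, Fintype.linearCombination_apply, map_sum, map_smul]
    refine Finset.sum_congr rfl fun i _ => ?_
    ext w
    simp [Rat.smul_def]
  have hτq : ∀ q : Fin r → ℚ, τ (fun i => (q i : ℝ)) = comb q := fun q => by
    simp only [τ, comb, Fintype.linearCombination_apply, CompletedSpace.ratCast_smul]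
    change _ = UniformSpace.Completion.toComplL (𝕜 := ℚ) (E := AlgModTorsion) _
    simp only [map_sum, map_smul]
    rfl
  -- Both sides are continuous in $c$, and for rational $c$ this is the height formula on $V_{K,S}$.
  have hiso : ∀ c, Module.finrank ℚ K * ‖τ c‖ = ∑ w ∈ placesWith (placesOver K S), |Λ c w| := by
    intro c
    have hdense : DenseRange fun (q : Fin r → ℚ) (i : Fin r) => (q i : ℝ) :=
      DenseRange.piMap fun _ => Rat.denseRange_cast
    refine hdense.induction_on (p := fun c => Module.finrank ℚ K * ‖τ c‖ =
      ∑ w ∈ placesWith (placesOver K S), |Λ c w|) c ?_ fun q => ?_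
    · have h1 : Continuous τ := τ.continuous_of_finiteDimensional
      have h2 : ∀ w, Continuous fun c => Λ c w := fun w =>
        ((LinearMap.proj w).comp Λ).continuous_of_finiteDimensional
      exact isClosed_eq (by fun_prop) (continuous_finsetSum _ fun w _ => (h2 w).abs)
    · rw [hτq, hΛq, UniformSpace.Completion.norm_coe, ← sum_abs_placeLog (hcomb q).1 _
        (placeLog_eq_zero_of_mem hS (hcomb q))]
      rfl
  have hrep : ∀ b ∈ sUnitSpace K S, ∃ q, comb q = b := fun b hb => by
    refine ⟨fun i => e.repr ⟨b, hb⟩ i, ?_⟩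
    have := congrArg Subtype.val (e.sum_repr ⟨b, hb⟩)
    rw [AddSubmonoidClass.coe_finsetSum] at this
    exact this
  have hrange : LinearMap.range Λ = logSpan K K S := by
    apply le_antisymm
    · rintro _ ⟨c, rfl⟩
      rw [Fintype.linearCombination_apply]
      exact Submodule.sum_mem _ fun i _ => Submodule.smul_mem _ _
        (Submodule.subset_span ⟨_, (e i).2, rfl⟩)
    · rw [logSpan, Submodule.span_le]
      rintro _ ⟨b, hb, rfl⟩
      obtain ⟨q, rfl⟩ := hrep b hb
      exact ⟨_, hΛq q⟩
  -- Injectivity of $\Lambda$ is not needed: the norm identity puts its kernel inside that of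
  -- $\tau$, so $\tau$ factors through the range of $\Lambda$.
  have hker : ∀ c, Λ c = 0 → τ c = 0 := fun c hc => by
    have := hiso c
    simp only [hc, Pi.zero_apply, abs_zero, Finset.sum_const_zero] at this
    exact norm_eq_zero.mp ((mul_eq_zero.mp this).resolve_left hK.ne')
  obtain ⟨s, hs⟩ := Λ.rangeRestrict.exists_rightInverse_of_surjective Λ.range_rangeRestrict
  obtain ⟨ρ, hρ⟩ := LinearMap.exists_extend (τ ∘ₗ s)
  have hρΛ : ∀ c, ρ (Λ c) = τ c := fun c => by
    have h1 : ρ (Λ c) = τ (s (Λ.rangeRestrict c)) := LinearMap.congr_fun hρ (Λ.rangeRestrict c)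
    have h2 : Λ (s (Λ.rangeRestrict c)) = Λ c :=
      congrArg Subtype.val (LinearMap.congr_fun hs (Λ.rangeRestrict c))
    rw [h1, ← sub_eq_zero, ← map_sub]
    exact hker _ (by rw [map_sub, h2, sub_self])
  refine ⟨hrange ▸ inferInstance, ρ, fun f hf => ?_, fun b hb => ?_⟩
  · rw [← hrange] at hf
    obtain ⟨c, rfl⟩ := hf
    rw [hρΛ, hiso]
  · obtain ⟨q, rfl⟩ := hrep b hb
    rw [← hΛq, hρΛ, hτq]

/-- The image is finite-dimensional, hence closed, so it contains the closure of $V_{E,S}$. -/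
theorem map_logSpan_eq (hS : ⊤ ∈ S) (hle : E ≤ K) [FiniteDimensional ℝ (logSpan K K S)]
    (ρ : (Place K → ℝ) →ₗ[ℝ] CompletedSpace)
    (hρ : ∀ b ∈ sUnitSpace K S, ρ (logVec K b) = b) :
    (logSpan K E S).map ρ = sUnitCompletion E S := by
  have hfd : FiniteDimensional ℝ (logSpan K E S) :=
    Submodule.finiteDimensional_of_le (logSpan_mono hS hle)
  apply le_antisymm
  · rw [logSpan, Submodule.map_span, Submodule.span_le]
    rintro _ ⟨_, ⟨b, hb, rfl⟩, rfl⟩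
    rw [hρ b (sUnitSpace_mono hS hle hb)]
    exact coe_mem_sUnitCompletion hb
  · refine closure_minimal ?_ (Submodule.closed_of_finiteDimensional _)
    rintro _ ⟨b, hb, rfl⟩
    exact ⟨logVec K b, Submodule.subset_span ⟨b, hb, rfl⟩, hρ b (sUnitSpace_mono hS hle hb)⟩

end Realization

/-! ### Cutting logarithm vectors off outside $S$. -/

section Truncation
variable {K : IntermediateField ℚ Qbar} [FiniteDimensional ℚ K] {S : Finset RatPlace}

variable (K S) in
open Classical in
/-- The logarithm vector cut off outside `S`, with the lost mass spread over the infinite places. -/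
def truncate : AlgModTorsion →ₗ[ℚ] (Place K → ℝ) :=
  LinearMap.pi <| Sum.elim
    (fun v => placeLog (Sum.inl v) - (Fintype.card (InfinitePlace K) : ℚ)⁻¹ •
      ∑ w ∈ placesWith (placesOver K S), placeLog w)
    (fun v => if v ∈ placesOver K S then placeLog (Sum.inr v) else 0)

theorem truncate_inl (b : AlgModTorsion) (v : InfinitePlace K) :
    truncate K S b (Sum.inl v) = placeLog (Sum.inl v) b -
      (Fintype.card (InfinitePlace K) : ℝ)⁻¹ * ∑ w ∈ placesWith (placesOver K S), placeLog w b := by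
  simp [truncate, Rat.smul_def]

theorem truncate_inr_of_mem (b : AlgModTorsion) {v : FinitePlace K} (hv : v ∈ placesOver K S) :
    truncate K S b (Sum.inr v) = placeLog (Sum.inr v) b := by
  simp [truncate, hv]

theorem truncate_inr_of_notMem (b : AlgModTorsion) {v : FinitePlace K} (hv : v ∉ placesOver K S) :
    truncate K S b (Sum.inr v) = 0 := by
  simp [truncate, hv]

theorem sum_truncate (b : AlgModTorsion) :
    ∑ w ∈ placesWith (placesOver K S), truncate K S b w = 0 := by
  have hc : (Fintype.card (InfinitePlace K) : ℝ) ≠ 0 := by exact_mod_cast Fintype.card_ne_zero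
  conv_lhs => rw [placesWith, Finset.sum_disjSum]
  rw [Finset.sum_congr rfl fun v hv => truncate_inr_of_mem b hv]
  simp only [truncate_inl, Finset.sum_sub_distrib, Finset.sum_const, Finset.card_univ, nsmul_eq_mul]
  rw [mul_inv_cancel_left₀ hc]
  conv_lhs => rw [placesWith, Finset.sum_disjSum]
  ring

theorem truncate_eq_logVec (hS : ⊤ ∈ S) {b : AlgModTorsion} (hb : b ∈ sUnitSpace K S) :
    truncate K S b = logVec K b := by
  ext (v | v)
  · rw [truncate_inl, sum_placeLog hb.1 _ (placeLog_eq_zero_of_mem hS hb), mul_zero, sub_zero]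
    rfl
  · by_cases hv : v ∈ placesOver K S
    · exact truncate_inr_of_mem b hv
    · rw [truncate_inr_of_notMem b hv]
      exact (placeLog_eq_zero_of_mem hS hb v hv).symm

/-- Both the cut-off at a Galois-stable set and the correction, constant on infinite places,
preserve invariance, so `mem_logSpan_iff` applies. The result need not be the logarithm vector of a
class, which is why real spans are used. -/
theorem truncate_mem [IsGalois ℚ K] {F : IntermediateField ℚ Qbar} [FiniteDimensional ℚ F]
    (hS : ⊤ ∈ S) (hle : F ≤ K) {b : AlgModTorsion} (hb : b ∈ fieldSpace F) :
    truncate K S b ∈ logSpan K F S := by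
  refine (mem_logSpan_iff hS hle).mpr
    ⟨fun v hv => truncate_inr_of_notMem b hv, sum_truncate b, fun g hg w => ?_⟩
  have h := fun w => placeLog_smul_of_mem_fixer hle hb hg w
  rcases w with v | v
  · rw [Sum.smul_inl, truncate_inl, truncate_inl, ← Sum.smul_inl, h]
  · rw [Sum.smul_inr]
    by_cases hv : v ∈ placesOver K S
    · rw [truncate_inr_of_mem b hv, truncate_inr_of_mem b (smul_mem_placesOver.mpr hv),
        ← Sum.smul_inr, h]
    · rw [truncate_inr_of_notMem b hv, truncate_inr_of_notMem b (smul_mem_placesOver.not.mpr hv)]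

/-- By the product formula the defect $s$ is minus the sum of the discarded coordinates. Spreading
it thus costs at most $|s|$, which is at most the discarded $\ell^1$ mass. -/
theorem sum_abs_truncate_le {b : AlgModTorsion} (hb : b ∈ fieldSpace K) :
    ∑ w ∈ placesWith (placesOver K S), |truncate K S b w| ≤ Module.finrank ℚ K * ‖b‖ := by
  classical
  have hc : (0 : ℝ) < Fintype.card (InfinitePlace K) := by exact_mod_cast Fintype.card_pos
  obtain ⟨T₀, hT₀⟩ := exists_support_placeLog hb
  let T := T₀ ∪ placesOver K S
  have hT : ∀ v ∉ T, placeLog (Sum.inr v : Place K) b = 0 := fun v hv =>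
    hT₀ v fun h => hv (Finset.mem_union_left _ h)
  have hsub : placesOver K S ⊆ T := Finset.subset_union_right
  rw [← sum_abs_placeLog hb T hT]
  have hz := sum_placeLog hb T hT
  set s := ∑ w ∈ placesWith (placesOver K S), placeLog w b with hs
  have hs' : |s| ≤ ∑ v ∈ T \ placesOver K S, |placeLog (Sum.inr v : Place K) b| := by
    have h1 : s = - ∑ v ∈ T \ placesOver K S, placeLog (Sum.inr v : Place K) b := by
      rw [placesWith, Finset.sum_disjSum, ← Finset.sum_sdiff hsub] at hz
      rw [hs, placesWith, Finset.sum_disjSum]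
      linarith
    rw [h1, abs_neg]
    exact Finset.abs_sum_le_sum_abs _ _
  rw [placesWith, placesWith, Finset.sum_disjSum, Finset.sum_disjSum,
    ← Finset.sum_sdiff (s₁ := placesOver K S) (s₂ := T) hsub]
  have h3 : ∑ v ∈ placesOver K S, |truncate K S b (Sum.inr v)| =
      ∑ v ∈ placesOver K S, |placeLog (Sum.inr v : Place K) b| :=
    Finset.sum_congr rfl fun v hv => by rw [truncate_inr_of_mem b hv]
  have h2 : ∑ v, |truncate K S b (Sum.inl v)| ≤
      ∑ v : InfinitePlace K, |placeLog (Sum.inl v : Place K) b| + |s| := by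
    calc _ ≤ ∑ v : InfinitePlace K, (|placeLog (Sum.inl v : Place K) b| +
          (Fintype.card (InfinitePlace K) : ℝ)⁻¹ * |s|) := by
          refine Finset.sum_le_sum fun v _ => ?_
          rw [truncate_inl]
          refine (abs_sub _ _).trans (le_of_eq ?_)
          rw [abs_mul, abs_of_pos (inv_pos.mpr hc)]
      _ = _ := by
          rw [Finset.sum_add_distrib, Finset.sum_const, Finset.card_univ, nsmul_eq_mul,
            mul_inv_cancel_left₀ hc.ne']
  linarith

end Truncation

/-! ### The shortening step for subfields $E\subseteq F$, and approximation from the completion. -/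

section Descent
variable {K : IntermediateField ℚ Qbar} [FiniteDimensional ℚ K] {S : Finset RatPlace}

instance : MulAction Gal(K/ℚ) (placesWith (placesOver K S)) where
  smul g w := ⟨g • w.1, (smul_mem_placesWith g).mpr w.2⟩
  one_smul w := Subtype.ext (one_smul _ w.1)
  mul_smul g h w := Subtype.ext (mul_smul g h w.1)

variable {E F : IntermediateField ℚ Qbar} [FiniteDimensional ℚ E] [FiniteDimensional ℚ F]

/-- `exists_l1_descent` for $\mathrm{Gal}(K/E)\supseteq\mathrm{Gal}(K/F)$: the group orders are
$[K:E]$ and $[K:F]$, so its rate becomes a ratio of the degrees of $E$ and $F$. -/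
theorem exists_logSpan_descent [IsGalois ℚ K] (hS : ⊤ ∈ S) (hEF : E ≤ F) (hFK : F ≤ K)
    {f β : Place K → ℝ} (hf : f ∈ logSpan K F S) (hβ : β ∈ logSpan K E S)
    (hlt : ∑ w ∈ placesWith (placesOver K S), |(f - β) w| <
      ∑ w ∈ placesWith (placesOver K S), |f w|) :
    ∃ β' ∈ logSpan K E S, β' ≠ 0 ∧
      (Module.finrank ℚ E : ℝ) * ∑ w ∈ placesWith (placesOver K S), |β' w| ≤
        Module.finrank ℚ F * (∑ w ∈ placesWith (placesOver K S), |f w| -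
          ∑ w ∈ placesWith (placesOver K S), |(f - β') w|) := by
  classical
  have hEK := hEF.trans hFK
  obtain ⟨-, -, hfinv⟩ := (mem_logSpan_iff hS hFK).mp hf
  obtain ⟨-, hβsum, hβinv⟩ := (mem_logSpan_iff hS hEK).mp hβ
  have conv : ∀ u : Place K → ℝ, ∑ w ∈ placesWith (placesOver K S), u w =
      ∑ w : placesWith (placesOver K S), u w := fun u => (Finset.sum_coe_sort _ u).symm
  let H := (fixer K F).subgroupOf (fixer K E)
  have hH : Nat.card H = Nat.card (fixer K F) :=
    Nat.card_congr (Subgroup.subgroupOfEquivOfLe (fixer_anti hEF)).toEquiv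
  obtain ⟨γ, hγinv, hγsum, hγ0, hγ⟩ := exists_l1_descent (G := fixer K E) H
    (fun w : placesWith (placesOver K S) => f w) (fun w => β w)
    (fun h hh w => hfinv h.1 (Subgroup.mem_subgroupOf.mp hh) w)
    (fun g w => hβinv g.1 g.2 w) ((conv β).symm.trans hβsum)
    (by rw [conv, conv] at hlt; exact hlt)
  let β' : Place K → ℝ := fun w => if hw : w ∈ placesWith (placesOver K S) then γ ⟨w, hw⟩ else 0
  have hβ' : ∀ w : placesWith (placesOver K S), β' w = γ w := fun w => dif_pos w.2
  refine ⟨β', (mem_logSpan_iff hS hEK).mpr ⟨fun v hv => dif_neg (inr_mem_placesWith.not.mpr hv),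
    ?_, fun g hg w => ?_⟩, fun h0 => hγ0 ?_, ?_⟩
  · rw [conv]; simp only [hβ', hγsum]
  · by_cases hw : w ∈ placesWith (placesOver K S)
    · exact (hβ' (g • ⟨w, hw⟩)).trans ((hγinv ⟨g, hg⟩ ⟨w, hw⟩).trans (hβ' ⟨w, hw⟩).symm)
    · have h1 : β' (g • w) = 0 := dif_neg ((smul_mem_placesWith g).not.mpr hw)
      have h2 : β' w = 0 := dif_neg hw
      rw [h1, h2]
  · ext w
    rw [← hβ', h0]; rfl
  · rw [conv, conv, conv]
    simp only [Pi.sub_apply, hβ']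
    have hE : (Nat.card (fixer K E) : ℝ) * Module.finrank ℚ E = Module.finrank ℚ K := by
      exact_mod_cast card_fixer_mul_finrank K E hEK
    have hF : (Nat.card (fixer K F) : ℝ) * Module.finrank ℚ F = Module.finrank ℚ K := by
      exact_mod_cast card_fixer_mul_finrank K F hFK
    have hcF : (0 : ℝ) < Nat.card (fixer K F) := by exact_mod_cast Nat.card_pos
    have hdE : (0 : ℝ) ≤ Module.finrank ℚ E := Nat.cast_nonneg _
    rw [hH] at hγ
    have h1 := mul_le_mul_of_nonneg_left hγ hdE
    refine le_of_mul_le_mul_left ?_ hcF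
    calc _ = _ := mul_left_comm _ _ _
      _ ≤ _ := h1
      _ = _ := by rw [← mul_assoc, ← mul_assoc, mul_comm (Module.finrank ℚ E : ℝ), hE, hF]

end Descent

/-- The extremal norm is bounded by the cost of any decomposition in the completions. -/
theorem extremalNorm₁_le_of_completion {K : IntermediateField ℚ Qbar} [FiniteDimensional ℚ K]
    {S : Finset RatPlace} {α : AlgModTorsion} (hα : α ∈ fieldSpace K)
    (a : Set.Iic K → CompletedSpace) (ha : ∀ F : Set.Iic K, a F ∈ sUnitCompletion F.1 S)
    (hsum : (α : CompletedSpace) = ∑ F, a F) :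
    extremalNorm₁ α ≤ ∑ F : Set.Iic K, (Module.finrank ℚ F.1 : ℝ) * ‖a F‖ := by
  classical
  let d : Set.Iic K → ℝ := fun F => Module.finrank ℚ F.1
  have hd : ∀ F, 0 ≤ d F := fun F => Nat.cast_nonneg _
  let top : Set.Iic K := ⟨K, le_refl K⟩
  -- The total error is at most $C\varepsilon$: the first term covers the approximation of the
  -- components, the second the residue placed in the component of $K$, and $1$ ensures $C>0$.
  let C : ℝ := ∑ F, d F + d top * Fintype.card (Set.Iic K) + 1
  have hC : 0 < C := by
    have h1 : 0 ≤ ∑ F, d F := Finset.sum_nonneg fun F _ => hd F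
    have h2 := mul_nonneg (hd top) (Nat.cast_nonneg (Fintype.card (Set.Iic K)) (α := ℝ))
    simp only [C]
    linarith
  refine le_of_forall_pos_le_add fun δ hδ => ?_
  let ε := δ / C
  have hε : 0 < ε := div_pos hδ hC
  have happrox : ∀ F : Set.Iic K, ∃ b ∈ sUnitSpace F.1 S, ‖a F - (b : CompletedSpace)‖ < ε := by
    intro F
    obtain ⟨_, ⟨b, hb, rfl⟩, hlt⟩ := Metric.mem_closure_iff.mp (ha F) ε hε
    exact ⟨b, hb, by rwa [← dist_eq_norm]⟩
  choose b hb hlt using happrox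
  -- The approximants no longer sum to $\alpha$; the small residue lies in $V_K$ and is charged to
  -- the component of $K$.
  let η := α - ∑ F, b F
  have hη : ‖η‖ ≤ Fintype.card (Set.Iic K) * ε := by
    have h1 : (η : CompletedSpace) = ∑ F, (a F - (b F : CompletedSpace)) := by
      rw [Finset.sum_sub_distrib, ← hsum, UniformSpace.Completion.coe_sub]
      congr 1
      exact map_sum (UniformSpace.Completion.toComplL (𝕜 := ℚ) (E := AlgModTorsion)) _ _
    rw [← UniformSpace.Completion.norm_coe, h1]
    refine (norm_sum_le _ _).trans ((Finset.sum_le_sum fun F _ => (hlt F).le).trans ?_)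
    simp
  have hbF : ∀ F : Set.Iic K, ‖b F‖ ≤ ‖a F‖ + ε := fun F => by
    rw [← UniformSpace.Completion.norm_coe]
    have := norm_sub_norm_le (b F : CompletedSpace) (a F)
    rw [norm_sub_rev] at this
    linarith [hlt F]
  have hmem : ∀ F : Set.Iic K, b F ∈ fieldSpace F.1 := fun F => (hb F).1
  have hηK : η ∈ fieldSpace K :=
    sub_mem hα (Submodule.sum_mem _ fun F _ => fieldSpace_mono F.2 (hmem F))
  have hle := extremalNorm₁_le (α := α) (fun F => b F + if F = top then η else 0)
    (fun F => by
      split_ifs with h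
      · subst h; exact add_mem (hmem _) hηK
      · rw [add_zero]; exact hmem F)
    (by rw [Finset.sum_add_distrib, Finset.sum_ite_eq' Finset.univ top]; simp [η])
  refine hle.trans ?_
  calc ∑ F, d F * ‖b F + if F = top then η else 0‖
      ≤ ∑ F, (d F * ‖a F‖ + d F * ε + if F = top then d top * ‖η‖ else 0) := by
        refine Finset.sum_le_sum fun F _ => ?_
        have h1 := mul_le_mul_of_nonneg_left (hbF F) (hd F)
        split_ifs with h
        · subst h
          have h2 := mul_le_mul_of_nonneg_left (norm_add_le (b top) η) (hd top)
          linarith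
        · rw [add_zero]; linarith
    _ = ∑ F, d F * ‖a F‖ + (∑ F, d F) * ε + d top * ‖η‖ := by
        rw [Finset.sum_add_distrib, Finset.sum_add_distrib, Finset.sum_ite_eq' Finset.univ top,
          Finset.sum_mul]
        simp
    _ ≤ ∑ F, d F * ‖a F‖ + C * ε := by
        have := mul_le_mul_of_nonneg_left hη (hd top)
        simp only [C]
        linarith
    _ = _ := by rw [mul_div_cancel₀ _ hC.ne']

end WeilHeight
end

/-! ### The theorem. -/

open WeilHeight
theorem theorem1 (K : IntermediateField ℚ Qbar) [FiniteDimensional ℚ K] [IsGalois ℚ K]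
    (α : AlgModTorsion) (hα : α ∈ fieldSpace K) :
    ∃ S : Finset RatPlace, ⊤ ∈ S ∧
      (∀ F : Set.Iic K, FiniteDimensional ℚ (sUnitSpace F.1 S) ∧
        FiniteDimensional ℝ (sUnitCompletion F.1 S)) ∧
      ∃ a : Set.Iic K → CompletedSpace,
        (∀ F : Set.Iic K, a F ∈ sUnitCompletion F.1 S) ∧
        (α : CompletedSpace) = ∑ F : Set.Iic K, a F ∧
        extremalNorm₁ α = ∑ F : Set.Iic K, (Module.finrank ℚ F.1 : ℝ) * ‖a F‖ ∧
        ∀ E F : Set.Iic K, E < F →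
          ‖a F‖ = ⨅ β : sUnitSpace E.1 S, ‖a F - ((β : AlgModTorsion) : CompletedSpace)‖ := by
  classical
  obtain ⟨S, hS, hαS⟩ := exists_sUnitSpace_mem hα
  obtain ⟨hfd, ρ, hnorm, hρ⟩ := exists_realization (K := K) hS
  have hmap : ∀ F : Set.Iic K, (logSpan K F.1 S).map ρ = sUnitCompletion F.1 S := fun F =>
    map_logSpan_eq hS F.2 ρ hρ
  have hfdU : ∀ F : Set.Iic K, FiniteDimensional ℝ (sUnitCompletion F.1 S) := fun F => by
    have : FiniteDimensional ℝ (logSpan K F.1 S) :=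
      Submodule.finiteDimensional_of_le (logSpan_mono hS F.2)
    rw [← hmap F]
    infer_instance
  have hK : (0 : ℝ) < Module.finrank ℚ K := mod_cast Module.finrank_pos
  let top : Set.Iic K := ⟨K, le_refl K⟩
  have hsingle : ∑ F : Set.Iic K, ((if h : F = top then ⟨(α : CompletedSpace), by
      subst h; exact coe_mem_sUnitCompletion hαS⟩ else 0 : sUnitCompletion F.1 S) :
        CompletedSpace) = α := by
    rw [Fintype.sum_eq_single top fun F hF => by rw [dif_neg hF]; rfl, dif_pos rfl]
  -- The initial decomposition puts all of $\alpha$ in the component of $K$.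
  obtain ⟨t, htsum, htmin, htdesc⟩ := exists_optimal (fun F : Set.Iic K => sUnitCompletion F.1 S)
    (fun F => (Module.finrank ℚ F.1 : ℝ)) (fun F => mod_cast Module.finrank_pos)
    (fun E F hEF => by
      have hle : E.1 ≤ F.1 := hEF.le
      have h1 := IntermediateField.finrank_le_of_le_right hle
      refine Nat.cast_lt.mpr (lt_of_le_of_ne h1 fun h => hEF.ne (Subtype.ext ?_))
      exact IntermediateField.eq_of_le_of_finrank_eq hle h)
    (fun F => if h : F = top then ⟨(α : CompletedSpace), by
      subst h; exact coe_mem_sUnitCompletion hαS⟩ else 0) (by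
    intro E F hEF x hx β hβ hlt
    have hle : E.1 ≤ F.1 := hEF.le
    rw [← hmap] at hx hβ
    obtain ⟨f, hf, rfl⟩ := hx
    obtain ⟨g, hg, rfl⟩ := hβ
    have hfK := logSpan_mono hS F.2 hf
    have hgK := logSpan_mono hS E.2 hg
    rw [← map_sub] at hlt
    have hlt' := mul_lt_mul_of_pos_left hlt hK
    rw [hnorm _ (sub_mem hfK hgK), hnorm _ hfK] at hlt'
    obtain ⟨γ, hγ, hγ0, hγle⟩ := exists_logSpan_descent hS hle F.2 hf hg hlt'
    have hγK := logSpan_mono hS E.2 hγ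
    rw [← hnorm _ hγK, ← hnorm _ hfK, ← hnorm _ (sub_mem hfK hγK)] at hγle
    refine ⟨ρ γ, hmap E ▸ ⟨γ, hγ, rfl⟩, hmap F ▸ ⟨γ, logSpan_mono hS hle hγ, rfl⟩, fun h => hγ0 ?_,
      ?_⟩
    -- On the span a logarithm vector vanishes outside `placesWith`, so zero norm of its image
    -- forces it to vanish.
    · have h1 := hnorm γ hγK
      rw [h, norm_zero, mul_zero, eq_comm, Finset.sum_eq_zero_iff_of_nonneg
        fun _ _ => abs_nonneg _] at h1
      have hγv := ((mem_logSpan_iff hS E.2).mp hγ).1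
      ext w
      by_cases hw : w ∈ placesWith (placesOver K S)
      · exact abs_eq_zero.mp (h1 w hw)
      · rcases w with v | v
        · exact absurd (inl_mem_placesWith _ v) hw
        · exact hγv v (inr_mem_placesWith.not.mp hw)
    · rw [← map_sub]
      refine le_of_mul_le_mul_left ?_ hK
      calc _ = _ := mul_left_comm _ _ _
        _ ≤ _ := hγle
        _ = _ := by ring)
  rw [hsingle] at htsum htmin
  refine ⟨S, hS, fun F => ⟨finiteDimensional_sUnitSpace hS, hfdU F⟩, fun F => t F,
    fun F => (t F).2, htsum.symm, le_antisymm ?_ ?_, fun E F hEF => ?_⟩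
  · exact extremalNorm₁_le_of_completion hα _ (fun F => (t F).2) htsum.symm
  · refine le_csInf ⟨_, 1, fun _ => 1, fun _ => α, by simp, rfl⟩ ?_
    rintro _ ⟨n, r, b, hsum, rfl⟩
    -- Any competitor is moved to the subfields of $K$ and then truncated. Both operations keep the
    -- sum $\alpha$ and do not raise the cost, so the minimality of $t$ applies.
    obtain ⟨β, hβ, hβsum, hβle⟩ := exists_subfield_decomposition hα r b hsum
    have hmem : ∀ F : Set.Iic K, truncate K S (β F) ∈ logSpan K F.1 S := fun F =>
      truncate_mem hS F.2 (hβ F)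
    refine le_trans (htmin (fun F => ⟨ρ (truncate K S (β F)), hmap F ▸ ⟨_, hmem F, rfl⟩⟩) ?_) ?_
    · change ∑ F, ρ (truncate K S (β F)) = α
      rw [← map_sum, ← map_sum, ← hβsum, truncate_eq_logVec hS hαS, hρ α hαS]
    · refine le_trans (Finset.sum_le_sum fun F _ => mul_le_mul_of_nonneg_left ?_
        (Nat.cast_nonneg _)) hβle
      change ‖ρ (truncate K S (β F))‖ ≤ ‖β F‖
      refine le_of_mul_le_mul_left ?_ hK
      rw [hnorm _ (logSpan_mono hS F.2 (hmem F))]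
      exact sum_abs_truncate_le (fieldSpace_mono F.2 (hβ F))
  · refine le_antisymm (le_ciInf fun β => htdesc E F hEF _ (coe_mem_sUnitCompletion β.2)) ?_
    -- The infimum is attained at the trivial class.
    refine (ciInf_le ⟨0, ?_⟩ 0).trans_eq ?_
    · rintro _ ⟨β, rfl⟩
      exact norm_nonneg _
    · rw [Submodule.coe_zero, UniformSpace.Completion.coe_zero, sub_zero]
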